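/- Let $n\ge 0$, let $d$ be a positive odd integer and $\ell=\sqrt{2\pi/d}$. Write vectors of length $2n$ as $\mathbf a=(\mathbf a_X,\mathbf a_Z)$, let $\Omega=\begin{pmatrix}0&\mathbb 1\\-\mathbb 1&0\end{pmatrix}$ and $[\mathbf a,\mathbf b]=\mathbf a^T\Omega\mathbf b$. On $L^2(\mathbb R^n)$ let $\hat{\mathbf r}=(\hat q_1,\dots,\hat q_n,\hat p_1,\dots,\hat p_n)^T$ be the position and momentum operators ($\hat q_j$ is multiplication by $x_j$, $\hat p_j=-i\partial_j$), let $\hat D(\mathbf b)=e^{i\mathbf b^T\Omega\hat{\mathbf r}}$ be the displacement operators and $\hat T_{\mathbf a}=\hat D(-\ell\mathbf a)$. For a density operator $\hat\rho$ on $L^2(\mathbb R^n)$ the multimode Zak-Gross Wigner function is $$W_{\hat\rho}(\boldsymbol\eta)=\frac1{(2\pi)^n}\sum_{\mathbf a\in\mathbb Z^{2n}}e^{i\ell[\mathbf a,\boldsymbol\eta]+i\pi\mathbf a_X^T\mathbf a_Z}\,\mathrm{Tr}(\hat\rho\,\hat T_{\mathbf a}),\qquad\boldsymbol\eta\in\mathbb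 R^{2n},$$ which is $d\ell$-periodic in each coordinate. The series always converges as a tempered distribution in $\boldsymbol\eta$ (integrated term by term against Schwartz functions); pointwise it is understood as an unconditional sum, at the points where it converges. Theorem. Let $S=\begin{pmatrix}A&B\\C&D\end{pmatrix}\in\mathrm{Sp}(2n,\mathbb Z)$ be an integer symplectic matrix and let $\hat U_S$ be a Gaussian unitary described by $S$, that is, a unitary operator on $L^2(\mathbb R^n)$ which maps Schwartz functions to Schwartz functions and satisfies $\hat U_S\hat{\mathbf r}\,\hat U_S^\dagger=S\hat{\mathbf r}$ on them (the convention in which $\hat U_S^\dagger\hat D(\mathbf b)\hat U_S=\hat D(S\mathbf b)$). Let $\bar{\mathbf t}\in\mathbb Z^{2n}$ be the vector of the diagonal entries of $A^TC\oplus B^TD$, and let $$\mathbf t=\frac{\pi}{\ell}\,S\,\Omega^{-1}\,\bar{\mathbf t}.$$ Then for every density operator $\hat\rho$ $$W_{\hat U_S\hat\rho\hat U_S^\dagger}(\boldsymbol\eta)=W_{\hat\rho}(S\boldsymbol\eta-\mathbf t).$$ This holds as an identity of tempered distributions, i.e. $\int W_{\hat U_S\hat\rho\hat U_S^\dagger}(\boldsymbol\eta)\varphi(\boldsymbol\eta)\,d\boldsymbol\eta=\int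 W_{\hat\rho}(\boldsymbol\xi)\,\varphi(S^{-1}(\boldsymbol\xi+\mathbf t))\,d\boldsymbol\xi$ for all Schwartz functions $\varphi$ on $\mathbb R^{2n}$, and also pointwise: for every $\boldsymbol\eta\in\mathbb R^{2n}$ the series for the left-hand side converges unconditionally if and only if the series for the right-hand side does, and then the two sums agree. Moreover $\mathbf t$ is efficiently computable: there is one integer random-access program which, for all $n$ and all $S\in\mathrm{Sp}(2n,\mathbb Z)$, computes from $n$ and $S$ the integer vector $S\Omega^{-1}\bar{\mathbf t}$ (the shift in units of $\pi/\ell$) at a logarithmic (bit) cost that is bounded by a polynomial in the total bit length of the entries of $S$. -/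

import Mathlib

open MeasureTheory Matrix
open scoped SchwartzMap LineDeriv

namespace ZakGross

noncomputable section

/-! ### Phase space of `n` modes

Phase-space vectors are indexed by `Fin n ⊕ Fin n`: the component `Sum.inl j` is the `j`-th entry
of the `X` part and `Sum.inr j` is the `j`-th entry of the `Z` part. -/

/-- The symplectic form `Ω = [[0, 1], [-1, 0]]`. -/
def Omega (n : ℕ) (R : Type*) [CommRing R] : Matrix (Fin n ⊕ Fin n) (Fin n ⊕ Fin n) R :=
  Matrix.fromBlocks 0 1 (-1) 0

/-- The symplectic product `[a, b] = aᵀ Ω b = a_X · b_Z - a_Z · b_X`. -/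
def sympl {n : ℕ} (a b : Fin n ⊕ Fin n → ℝ) : ℝ :=
  a ⬝ᵥ (Omega n ℝ *ᵥ b)

/-- `a_X · a_Z`. -/
def dotXZ {n : ℕ} {R : Type*} [CommRing R] (a : Fin n ⊕ Fin n → R) : R :=
  ∑ j, a (Sum.inl j) * a (Sum.inr j)

/-- An integer vector regarded as a real one. -/
def realVec {n : ℕ} (a : Fin n ⊕ Fin n → ℤ) : Fin n ⊕ Fin n → ℝ := fun i => (a i : ℝ)

/-- An integer matrix regarded as a real one. -/
def realMat {n : ℕ} (S : Matrix (Fin n ⊕ Fin n) (Fin n ⊕ Fin n) ℤ) :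
    Matrix (Fin n ⊕ Fin n) (Fin n ⊕ Fin n) ℝ := S.map (fun z : ℤ => (z : ℝ))

/-! ### Hilbert space, displacement operators, quadratures -/

/-- The Hilbert space `L²(ℝⁿ)` of `n` modes. -/
abbrev Modes (n : ℕ) : Type := Lp ℂ 2 (volume : Measure (Fin n → ℝ))

/-- The phase of the displacement operator `exp (i bᵀ Ω r̂) = exp (i (b_X · p̂ - b_Z · q̂))`. -/
def dispPhase {n : ℕ} (b : Fin n ⊕ Fin n → ℝ) (x : Fin n → ℝ) : ℝ :=
  -(∑ j, b (Sum.inr j) * x j) - dotXZ b / 2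

/-- `exp (i (b_X · p̂ - b_Z · q̂))` applied to the wave function `ψ`. -/
def dispFun {n : ℕ} (b : Fin n ⊕ Fin n → ℝ) (ψ : (Fin n → ℝ) → ℂ) (x : Fin n → ℝ) : ℂ :=
  Complex.exp (Complex.I * (dispPhase b x : ℂ)) * ψ (x + fun j => b (Sum.inl j))

theorem continuous_exp_dispPhase {n : ℕ} (b : Fin n ⊕ Fin n → ℝ) :
    Continuous fun x : Fin n → ℝ => Complex.exp (Complex.I * (dispPhase b x : ℂ)) := by
  unfold dispPhase; fun_prop

theorem memLp_shift {n : ℕ} (b : Fin n → ℝ) (ψ : Modes n) :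
    MemLp (fun x : Fin n → ℝ => ψ (x + b)) 2 (volume : Measure (Fin n → ℝ)) :=
  (Lp.memLp ψ).comp_measurePreserving (measurePreserving_add_right volume b)

theorem memLp_dispFun {n : ℕ} (b : Fin n ⊕ Fin n → ℝ) (ψ : Modes n) :
    MemLp (dispFun b ψ) 2 (volume : Measure (Fin n → ℝ)) := by
  have h := memLp_shift (fun j => b (Sum.inl j)) ψ
  refine h.of_le ((continuous_exp_dispPhase b).aestronglyMeasurable.mul
    h.aestronglyMeasurable) (Filter.Eventually.of_forall fun x => ?_)
  simp [dispFun]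

theorem dispFun_congr {n : ℕ} (b : Fin n ⊕ Fin n → ℝ) {f g : (Fin n → ℝ) → ℂ}
    (h : f =ᵐ[volume] g) : dispFun b f =ᵐ[volume] dispFun b g := by
  have h' := (measurePreserving_add_right (volume : Measure (Fin n → ℝ))
    (fun j => b (Sum.inl j))).quasiMeasurePreserving.ae_eq_comp h
  filter_upwards [h'] with x hx
  simp only [Function.comp_apply] at hx
  simp [dispFun, hx]

/-- The displacement operator `D(b) = exp (i bᵀ Ω r̂)`, `r̂ = (q̂₁, …, q̂ₙ, p̂₁, …, p̂ₙ)`, where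
`q̂ⱼ` is multiplication by `xⱼ` and `p̂ⱼ = -i ∂ⱼ`:
`(D(b) ψ)(x) = exp (-i b_Z · x - i b_X · b_Z / 2) ψ (x + b_X)`. -/
def displacement {n : ℕ} (b : Fin n ⊕ Fin n → ℝ) : Modes n →L[ℂ] Modes n :=
  LinearMap.mkContinuous
    { toFun := fun ψ => (memLp_dispFun b ψ).toLp (dispFun b ψ)
      map_add' := by
        intro ψ χ
        rw [← MemLp.toLp_add]
        refine MemLp.toLp_congr _ _ ((dispFun_congr b (Lp.coeFn_add ψ χ)).trans ?_)
        exact Filter.Eventually.of_forall fun x => by simp [dispFun, mul_add]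
      map_smul' := by
        intro c ψ
        rw [RingHom.id_apply, ← MemLp.toLp_const_smul]
        refine MemLp.toLp_congr _ _ ((dispFun_congr b (Lp.coeFn_smul c ψ)).trans ?_)
        exact Filter.Eventually.of_forall fun x => by simp [dispFun, mul_left_comm] }
    1 (by
      intro ψ
      have h : eLpNorm (dispFun b ψ) 2 (volume : Measure (Fin n → ℝ)) = eLpNorm ψ 2 volume := by
        rw [← eLpNorm_comp_measurePreserving (Lp.aestronglyMeasurable ψ)
          (measurePreserving_add_right volume (fun j => b (Sum.inl j)))]
        refine eLpNorm_congr_norm_ae (Filter.Eventually.of_forall fun x => ?_)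
        simp [dispFun]
      rw [one_mul, Lp.norm_def ψ, ← h]
      exact (Lp.norm_toLp _ (memLp_dispFun b ψ)).le)

theorem coeFn_displacement {n : ℕ} (b : Fin n ⊕ Fin n → ℝ) (ψ : Modes n) :
    displacement b ψ =ᵐ[volume] dispFun b ψ :=
  (memLp_dispFun b ψ).coeFn_toLp

/-- The quadrature `r̂ᵢ` on Schwartz functions: `q̂ⱼ f = xⱼ f` and `p̂ⱼ f = -i ∂ⱼ f`. -/
def quadrature {n : ℕ} : Fin n ⊕ Fin n → 𝓢(Fin n → ℝ, ℂ) → 𝓢(Fin n → ℝ, ℂ)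
  | Sum.inl j, f => SchwartzMap.smulLeftCLM ℂ (fun x : Fin n → ℝ => x j) f
  | Sum.inr j, f => (-Complex.I) • ∂_{(Pi.single j 1 : Fin n → ℝ)} f

theorem quadrature_inl_apply {n : ℕ} (j : Fin n) (f : 𝓢(Fin n → ℝ, ℂ)) (x : Fin n → ℝ) :
    quadrature (Sum.inl j) f x = (x j : ℂ) * f x := by
  have h : Function.HasTemperateGrowth (fun x : Fin n → ℝ => x j) :=
    (ContinuousLinearMap.proj (R := ℝ) (φ := fun _ : Fin n => ℝ) j).hasTemperateGrowth
  simp [quadrature, SchwartzMap.smulLeftCLM_apply_apply h]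

theorem quadrature_inr_apply {n : ℕ} (j : Fin n) (f : 𝓢(Fin n → ℝ, ℂ)) (x : Fin n → ℝ) :
    quadrature (Sum.inr j) f x = -Complex.I * lineDeriv ℝ f x (Pi.single j 1) := by
  simp [quadrature, SchwartzMap.lineDerivOp_apply]

/-- `U` is a Gaussian unitary (without displacement part) described by the symplectic matrix `S`:
a unitary operator on `L²(ℝⁿ)` that acts linearly on the quadratures, `U r̂ U† = S r̂`, as operators
on Schwartz functions, which `U` leaves invariant. For the displacement operators this is the
convention `U† D(b) U = D(S b)`. -/
structure IsGaussianUnitary {n : ℕ} (S : Matrix (Fin n ⊕ Fin n) (Fin n ⊕ Fin n) ℝ)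
    (U : Modes n →L[ℂ] Modes n) : Prop where
  unitary : U ∈ unitary (Modes n →L[ℂ] Modes n)
  quadratures : ∀ f : 𝓢(Fin n → ℝ, ℂ), ∃ g : 𝓢(Fin n → ℝ, ℂ),
    U (f.toLp 2 volume) = g.toLp 2 volume ∧
    ∀ i, U ((quadrature i f).toLp 2 volume) =
      (∑ k, (S i k : ℂ) • quadrature k g).toLp 2 volume

/-! ### Trace and states -/

section Trace

variable {H : Type*} [NormedAddCommGroup H] [InnerProductSpace ℂ H] [CompleteSpace H]

/-- The index set of a Hilbert basis of `H`. -/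
def basisIndex (H : Type*) [NormedAddCommGroup H] [InnerProductSpace ℂ H] [CompleteSpace H] :
    Set H := (exists_hilbertBasis ℂ H).choose

/-- A Hilbert basis of `H`. -/
def basis (H : Type*) [NormedAddCommGroup H] [InnerProductSpace ℂ H] [CompleteSpace H] :
    HilbertBasis (basisIndex H) ℂ H := (exists_hilbertBasis ℂ H).choose_spec.choose

/-- The trace of an operator (for a trace-class operator it does not depend on the basis). -/
def opTrace (T : H →L[ℂ] H) : ℂ := ∑' i, inner ℂ (basis H i) (T (basis H i))

/-- Density operators: positive operators of trace one. -/
structure IsDensityOperator (ρ : H →L[ℂ] H) : Prop where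
  isPositive : ρ.IsPositive
  trace_one : HasSum (fun i => inner ℂ (basis H i) (ρ (basis H i))) 1

end Trace

/-! ### The Zak-Gross Wigner function -/

/-- `ℓ = √(2π/d)`. -/
def ell (d : ℕ) : ℝ := Real.sqrt (2 * Real.pi / d)

/-- `T_a = D(-ℓ a)`. -/
def logicalShift (d : ℕ) {n : ℕ} (a : Fin n ⊕ Fin n → ℝ) : Modes n →L[ℂ] Modes n :=
  displacement (-(ell d • a))

/-- The term of index `a ∈ ℤ²ⁿ` of `Tr (ρ A_η)`, that is,
`(2π)⁻ⁿ exp (iℓ[a, η] + iπ a_X · a_Z) Tr (ρ T_a)`. -/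
def wignerTerm (d : ℕ) {n : ℕ} (ρ : Modes n →L[ℂ] Modes n) (η : Fin n ⊕ Fin n → ℝ)
    (a : Fin n ⊕ Fin n → ℤ) : ℂ :=
  (1 / (2 * Real.pi) ^ n : ℂ) *
    Complex.exp (Complex.I * ((ell d * sympl (realVec a) η : ℝ) : ℂ)
      + Complex.I * Real.pi * ((dotXZ a : ℤ) : ℂ)) *
    opTrace (ρ * logicalShift d (realVec a))

/-- The Zak-Gross Wigner function `W_ρ(η) = Tr (ρ A_η)`; it is `dℓ`-periodic in each coordinate
of `η`. The value is meaningful at the points where the series converges. -/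
def zakGrossWigner (d : ℕ) {n : ℕ} (ρ : Modes n →L[ℂ] Modes n) (η : Fin n ⊕ Fin n → ℝ) : ℂ :=
  ∑' a, wignerTerm d ρ η a

/-- The term of index `a` of `∫ W_ρ(η) φ(η) dη`, the Zak-Gross Wigner function smeared with `φ`. -/
def smearedTerm (d : ℕ) {n : ℕ} (ρ : Modes n →L[ℂ] Modes n) (φ : (Fin n ⊕ Fin n → ℝ) → ℂ)
    (a : Fin n ⊕ Fin n → ℤ) : ℂ :=
  ∫ η, wignerTerm d ρ η a * φ η

/-- The Zak-Gross Wigner function as a (periodic, tempered) distribution: `φ ↦ ∫ W_ρ(η) φ(η) dη`,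
the series `Tr (ρ A_η)` being integrated term by term. -/
def smearedWigner (d : ℕ) {n : ℕ} (ρ : Modes n →L[ℂ] Modes n)
    (φ : (Fin n ⊕ Fin n → ℝ) → ℂ) : ℂ :=
  ∑' a, smearedTerm d ρ φ a

/-! ### The shift -/

/-- The diagonal of `AᵀC ⊕ BᵀD`, where `S = [[A, B], [C, D]]`. -/
def tbar {n : ℕ} (S : Matrix (Fin n ⊕ Fin n) (Fin n ⊕ Fin n) ℤ) : Fin n ⊕ Fin n → ℤ :=
  Matrix.diag (Matrix.fromBlocks (S.toBlocks₁₁ᵀ * S.toBlocks₂₁) 0 0 (S.toBlocks₁₂ᵀ * S.toBlocks₂₂))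

/-- The integer vector `S Ω⁻¹ t̄`. -/
def shiftCoeff {n : ℕ} (S : Matrix (Fin n ⊕ Fin n) (Fin n ⊕ Fin n) ℤ) : Fin n ⊕ Fin n → ℤ :=
  (S * (Omega n ℤ)⁻¹) *ᵥ tbar S

/-- The shift `t = (π/ℓ) S Ω⁻¹ t̄`. -/
def shift (d : ℕ) {n : ℕ} (S : Matrix (Fin n ⊕ Fin n) (Fin n ⊕ Fin n) ℤ) : Fin n ⊕ Fin n → ℝ :=
  (Real.pi / ell d) • realVec (shiftCoeff S)

end

/-! ### A machine model with bit cost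

Integer random-access programs with countably many registers and arrays (a program uses finitely
many of them), all holding integers of unbounded size, under the logarithmic cost criterion: an
instruction costs at least the number of bits of the integers and addresses that it handles, and a
multiplication costs the product of the bit lengths of its factors. -/

/-- The contents of the registers and of the arrays. -/
structure State where
  reg : ℕ → ℤ
  arr : ℕ → ℕ → ℤ

/-- Programs. -/
inductive Prog : Type
  /-- `r := z` -/
  | const (r : ℕ) (z : ℤ)
  /-- `r := s + t` -/
  | add (r s t : ℕ)
  /-- `r := s - t` -/
  | sub (r s t : ℕ)
  /-- `r := s * t` -/
  | mul (r s t : ℕ)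
  /-- `r := k[s]` -/
  | load (r k s : ℕ)
  /-- `k[s] := r` -/
  | store (k s r : ℕ)
  /-- `P; Q` -/
  | seq (P Q : Prog)
  /-- run `P` as many times as the value of `r` on entry says -/
  | loop (r : ℕ) (P : Prog)

/-- The number of bits of an integer, with a sign bit. -/
def bits (z : ℤ) : ℕ := z.natAbs.size + 1

/-- Write `z` to the register `r`. -/
def State.setReg (σ : State) (r : ℕ) (z : ℤ) : State :=
  { σ with reg := Function.update σ.reg r z }

/-- Write `z` to the entry `i` of the array `k`. -/
def State.setArr (σ : State) (k i : ℕ) (z : ℤ) : State :=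
  { σ with arr := Function.update σ.arr k (Function.update (σ.arr k) i z) }

/-- The state after the run of a program, and the cost of the run. -/
def Prog.exec : Prog → State → State × ℕ
  | .const r z, σ => (σ.setReg r z, bits z)
  | .add r s t, σ => (σ.setReg r (σ.reg s + σ.reg t), bits (σ.reg s) + bits (σ.reg t))
  | .sub r s t, σ => (σ.setReg r (σ.reg s - σ.reg t), bits (σ.reg s) + bits (σ.reg t))
  | .mul r s t, σ => (σ.setReg r (σ.reg s * σ.reg t), bits (σ.reg s) * bits (σ.reg t))
  | .load r k s, σ =>
      (σ.setReg r (σ.arr k (σ.reg s).toNat),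
        bits (σ.reg s) + bits (σ.arr k (σ.reg s).toNat))
  | .store k s r, σ =>
      (σ.setArr k (σ.reg s).toNat (σ.reg r), bits (σ.reg s) + bits (σ.reg r))
  | .seq P Q, σ =>
      ((Q.exec (P.exec σ).1).1, (P.exec σ).2 + (Q.exec (P.exec σ).1).2)
  | .loop r P, σ =>
      (fun τ : State × ℕ => ((P.exec τ.1).1, τ.2 + (P.exec τ.1).2 + bits (σ.reg r)))^[
        (σ.reg r).toNat] (σ, bits (σ.reg r))

/-- The position `0, …, 2n - 1` of an index: first the `X` part, then the `Z` part. -/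
def position {n : ℕ} (i : Fin n ⊕ Fin n) : ℕ := (finSumFinEquiv i : Fin (n + n))

/-- The `2n × 2n` matrix `S` written row by row into an array, which is zero elsewhere. -/
def matrixArray {n : ℕ} (S : Matrix (Fin n ⊕ Fin n) (Fin n ⊕ Fin n) ℤ) (m : ℕ) : ℤ :=
  if h : m < (n + n) * (n + n) then
    S (finSumFinEquiv.symm (finProdFinEquiv.symm ⟨m, h⟩).1)
      (finSumFinEquiv.symm (finProdFinEquiv.symm ⟨m, h⟩).2)
  else 0

/-- The input: `n` in register `0`, the matrix `S` in array `0`, and zero everywhere else. -/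
def inputState {n : ℕ} (S : Matrix (Fin n ⊕ Fin n) (Fin n ⊕ Fin n) ℤ) : State where
  reg := fun r => if r = 0 then (n : ℤ) else 0
  arr := fun k => if k = 0 then matrixArray S else fun _ => 0

/-- The bit length of the matrix `S`. -/
def bitLength {n : ℕ} (S : Matrix (Fin n ⊕ Fin n) (Fin n ⊕ Fin n) ℤ) : ℕ :=
  ∑ i, ∑ j, bits (S i j)

/-- The integer vector-valued function `f` of the `2n × 2n` integer matrices with the property `p`
is computable in polynomial time: one program computes it for all `n` and leaves the result in
array `1`, at a cost polynomial in the bit length of the matrix. -/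
def PolyTimeOn (p : ∀ n : ℕ, Matrix (Fin n ⊕ Fin n) (Fin n ⊕ Fin n) ℤ → Prop)
    (f : ∀ n : ℕ, Matrix (Fin n ⊕ Fin n) (Fin n ⊕ Fin n) ℤ → Fin n ⊕ Fin n → ℤ) : Prop :=
  ∃ (P : Prog) (c k : ℕ), ∀ (n : ℕ) (S : Matrix (Fin n ⊕ Fin n) (Fin n ⊕ Fin n) ℤ), p n S →
    (∀ i, (P.exec (inputState S)).1.arr 1 (position i) = f n S i) ∧
    (P.exec (inputState S)).2 ≤ c * (bitLength S + 1) ^ k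

end ZakGross

/-! The identity holds term by term, up to a relabelling of the index lattice. By cyclicity of the
trace, Tr(UρU† T_a) = Tr(ρ U†T_aU) = Tr(ρ T_{Sa}), and a ↦ Sa permutes ℤ²ⁿ, so it remains to compare
the phases at a and at Sa. The symplectic part is invariant, [a, η] = [Sa, Sη]. The sign is not:
(Sa)_X·(Sa)_Z is a_X·a_Z plus the quadratic forms of AᵀC and BᵀD modulo 2. These matrices are
symmetric, so modulo 2 their forms are linear and equal a·t̄ (`even_dotXZ_mulVec_sub`). A linear
phase is a translation of η, and t is the vector with ℓ[Sa, t] = π a·t̄ (`exp_phase_eq`).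

Two analytic points need work. First, U is given only through the quadratures on Schwartz functions.
The covariance U D(b) = D(b') U is obtained by differentiating ⟨D(sb')g, U D(sb)f⟩ in s: U
intertwines the generators and generators are skew, so the derivative is zero
(`IsGaussianUnitary.mul_displacement`). Second, `opTrace` refers to one fixed basis. Writing ρ = σ²
with σ Hilbert-Schmidt makes the relevant double series absolutely summable, which gives basis
independence and cyclicity (`opTrace_conj`).

The smeared series converges since the traces are bounded by 1 and the Fourier coefficients of a
Schwartz function decay rapidly. For the complexity claim, an explicit program with nested loops
evaluates the defining sums. Its intermediate values are at most cubic in the entries, up to a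
factor polynomial in n, so they have linearly many bits. -/

namespace ZakGross

/-! ### Hilbert-Schmidt sums and the trace -/

section HilbertSchmidt

variable {H : Type*} [NormedAddCommGroup H] [InnerProductSpace ℂ H] {ι κ : Type*}

/-- Parseval families, for instance Hilbert bases. -/
def IsParseval (f : ι → H) : Prop :=
  ∀ x y : H, HasSum (fun i => inner ℂ x (f i) * inner ℂ (f i) y) (inner ℂ x y)

theorem IsParseval.hasSum_norm_sq {f : ι → H} (hf : IsParseval f) (x : H) :
    HasSum (fun i => ‖inner ℂ x (f i)‖ ^ 2) (‖x‖ ^ 2) := by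
  have h := Complex.hasSum_re (hf x x)
  rw [inner_self_eq_norm_sq_to_K] at h
  convert h using 2 with i
  · rw [← inner_conj_symm (f i) x, Complex.mul_conj, Complex.ofReal_re, Complex.normSq_eq_norm_sq]
  · norm_cast

theorem IsParseval.summable_norm_sq_inner {f : ι → H} {g : κ → H}
    (hg : IsParseval g) {A : H →L[ℂ] H} (hA : Summable fun i => ‖A (f i)‖ ^ 2) :
    Summable fun p : ι × κ => ‖inner ℂ (A (f p.1)) (g p.2)‖ ^ 2 := by
  refine (summable_prod_of_nonneg (f := fun p : ι × κ => ‖inner ℂ (A (f p.1)) (g p.2)‖ ^ 2)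
    fun p => sq_nonneg _).2 ⟨fun i => (hg.hasSum_norm_sq (A (f i))).summable, ?_⟩
  have h : (fun i => ∑' j, ‖inner ℂ (A (f i)) (g j)‖ ^ 2) = fun i => ‖A (f i)‖ ^ 2 :=
    funext fun i => (hg.hasSum_norm_sq (A (f i))).tsum_eq
  exact h ▸ hA

variable [CompleteSpace H]

theorem isParseval_basis : IsParseval (fun i => basis H i) :=
  fun x y => (basis H).hasSum_inner_mul_inner x y

/-- Moving U from an operator onto the basis vectors produces this family; asking only for the
Parseval identity avoids building a new `HilbertBasis`. -/
theorem IsParseval.map_star {f : ι → H} (hf : IsParseval f) {U : H →L[ℂ] H}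
    (hU : U ∈ unitary (H →L[ℂ] H)) : IsParseval fun i => star U (f i) := by
  intro x y
  have h := hf (U x) (U y)
  simp only [ContinuousLinearMap.star_eq_adjoint, ContinuousLinearMap.adjoint_inner_left,
    ContinuousLinearMap.adjoint_inner_right]
  have h1 : star U * U = 1 := Unitary.star_mul_self_of_mem hU
  have h2 : inner ℂ (U x) (U y) = inner ℂ x y := by
    rw [← ContinuousLinearMap.adjoint_inner_right, ← ContinuousLinearMap.star_eq_adjoint,
      ← mul_apply_eq_comp, h1, one_apply_eq_self]
  rwa [h2] at h

theorem IsParseval.summable_norm_sq_adjoint {f : ι → H} {g : κ → H} (hf : IsParseval f)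
    (hg : IsParseval g) {A : H →L[ℂ] H} (hA : Summable fun i => ‖A (f i)‖ ^ 2) :
    Summable fun j => ‖star A (g j)‖ ^ 2 := by
  have h := (hg.summable_norm_sq_inner hA).prod_symm.prod
  refine h.congr fun j => ?_
  rw [← (hf.hasSum_norm_sq _).tsum_eq]
  refine tsum_congr fun i => ?_
  rw [Prod.fst_swap, Prod.snd_swap, ContinuousLinearMap.star_eq_adjoint,
    ContinuousLinearMap.adjoint_inner_left, ← inner_conj_symm, RCLike.norm_conj]

/-- Both sides are iterated sums of ⟨A fᵢ, gⱼ⟩⟨gⱼ, B fᵢ⟩. The Hilbert-Schmidt hypotheses make the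
double series absolutely summable, so the order can be exchanged. This is the source of both basis
independence and cyclicity. -/
theorem IsParseval.tsum_inner_adjoint {f : ι → H} {g : κ → H} (hf : IsParseval f)
    (hg : IsParseval g) {A B : H →L[ℂ] H} (hA : Summable fun i => ‖A (f i)‖ ^ 2)
    (hB : Summable fun i => ‖B (f i)‖ ^ 2) :
    ∑' i, inner ℂ (A (f i)) (B (f i)) = ∑' j, inner ℂ (star B (g j)) (star A (g j)) := by
  have hs : Summable fun p : ι × κ =>
      inner ℂ (A (f p.1)) (g p.2) * inner ℂ (g p.2) (B (f p.1)) := by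
    refine Summable.of_norm_bounded ((hg.summable_norm_sq_inner hA).add
      (hg.summable_norm_sq_inner hB)) fun p => ?_
    rw [norm_mul, ← inner_conj_symm (g p.2), RCLike.norm_conj]
    generalize ‖inner ℂ (A (f p.1)) (g p.2)‖ = x
    generalize ‖inner ℂ (B (f p.1)) (g p.2)‖ = y
    nlinarith [sq_nonneg (x - y), sq_nonneg (x + y)]
  calc ∑' i, inner ℂ (A (f i)) (B (f i))
      = ∑' i, ∑' j, inner ℂ (A (f i)) (g j) * inner ℂ (g j) (B (f i)) :=
        tsum_congr fun i => (hg _ _).tsum_eq.symm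
    _ = ∑' j, ∑' i, inner ℂ (A (f i)) (g j) * inner ℂ (g j) (B (f i)) := hs.tsum_comm.symm
    _ = _ := tsum_congr fun j => by
        rw [← (hf _ _).tsum_eq]
        refine tsum_congr fun i => ?_
        simp only [ContinuousLinearMap.star_eq_adjoint, ContinuousLinearMap.adjoint_inner_left,
          ContinuousLinearMap.adjoint_inner_right]
        rw [mul_comm]

/-- A square root of a density operator. -/
theorem IsDensityOperator.exists_sqrt {ρ : H →L[ℂ] H} (hρ : IsDensityOperator ρ) :
    ∃ σ : H →L[ℂ] H, star σ = σ ∧ σ * σ = ρ ∧ HasSum (fun i => ‖σ (basis H i)‖ ^ 2) 1 := by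
  have h0 : 0 ≤ ρ := (ContinuousLinearMap.nonneg_iff_isPositive ρ).2 hρ.isPositive
  have hs : star (CFC.sqrt ρ) = CFC.sqrt ρ := (CFC.sqrt_nonneg ρ).isSelfAdjoint
  have hm : CFC.sqrt ρ * CFC.sqrt ρ = ρ := CFC.sqrt_mul_sqrt_self ρ h0
  refine ⟨CFC.sqrt ρ, hs, hm, ?_⟩
  have h := Complex.hasSum_re hρ.trace_one
  rw [Complex.one_re] at h
  convert h using 2 with i
  nth_rw 2 [← hm]
  rw [mul_apply_eq_comp]
  nth_rw 2 [← hs]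
  rw [ContinuousLinearMap.star_eq_adjoint, ContinuousLinearMap.adjoint_inner_right,
    inner_self_eq_norm_sq_to_K]
  norm_cast

/-- The right-hand side does not involve `f`, so the trace of σ²T is the same along every Parseval
family. The reason is the factorization into the Hilbert-Schmidt operators σ and σT. -/
theorem tsum_inner_mul_self_mul {σ : H →L[ℂ] H} (hσ : star σ = σ)
    (hsum : Summable fun i => ‖σ (basis H i)‖ ^ 2) (T : H →L[ℂ] H) {f : ι → H}
    (hf : IsParseval f) :
    ∑' i, inner ℂ (f i) ((σ * σ * T) (f i)) =
      ∑' j, inner ℂ (star (σ * T) (basis H j)) (σ (basis H j)) := by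
  have hb := isParseval_basis (H := H)
  have h1 : Summable fun i => ‖σ (f i)‖ ^ 2 := by
    have := hb.summable_norm_sq_adjoint hf hsum
    rwa [hσ] at this
  have h2 : Summable fun j => ‖star (σ * T) (basis H j)‖ ^ 2 := by
    refine Summable.of_nonneg_of_le (fun j => sq_nonneg _) (fun j => ?_)
      (hsum.mul_left (‖star T‖ ^ 2))
    rw [star_mul, hσ, mul_apply_eq_comp, ← mul_pow]
    gcongr
    exact (star T).le_opNorm _
  have h3 : Summable fun i => ‖(σ * T) (f i)‖ ^ 2 := by
    have := hb.summable_norm_sq_adjoint hf h2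
    rwa [star_star] at this
  have h4 := hf.tsum_inner_adjoint hb h1 h3
  rw [hσ] at h4
  rw [← h4]
  refine tsum_congr fun i => ?_
  rw [mul_assoc, mul_apply_eq_comp]
  nth_rw 1 [← hσ]
  rw [ContinuousLinearMap.star_eq_adjoint, ContinuousLinearMap.adjoint_inner_right]

/-- Conjugating by U amounts to evaluating the trace along the family U†eᵢ. -/
theorem opTrace_conj {ρ : H →L[ℂ] H} (hρ : IsDensityOperator ρ) {U : H →L[ℂ] H}
    (hU : U ∈ unitary (H →L[ℂ] H)) (T : H →L[ℂ] H) :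
    opTrace (U * (ρ * T) * star U) = opTrace (ρ * T) := by
  obtain ⟨σ, hσ, rfl, hsum⟩ := hρ.exists_sqrt
  have hb := isParseval_basis (H := H)
  rw [opTrace, opTrace, tsum_inner_mul_self_mul hσ hsum.summable T hb,
    ← tsum_inner_mul_self_mul hσ hsum.summable T (hb.map_star hU)]
  refine tsum_congr fun i => ?_
  rw [mul_assoc U, mul_apply_eq_comp U, ContinuousLinearMap.star_eq_adjoint,
    ContinuousLinearMap.adjoint_inner_left]
  rfl

/-- Cauchy-Schwarz in each term bounds it by ‖σeᵢ‖², and these numbers sum to Tr ρ = 1. -/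
theorem norm_opTrace_mul_le {ρ : H →L[ℂ] H} (hρ : IsDensityOperator ρ) {T : H →L[ℂ] H}
    (hT : ‖T‖ ≤ 1) : ‖opTrace (ρ * T)‖ ≤ 1 := by
  obtain ⟨σ, hσ, rfl, hsum⟩ := hρ.exists_sqrt
  rw [opTrace, tsum_inner_mul_self_mul hσ hsum.summable T isParseval_basis]
  refine tsum_of_norm_bounded hsum fun i => (norm_inner_le_norm _ _).trans ?_
  rw [sq, star_mul, hσ, mul_apply_eq_comp]
  gcongr
  exact (star T).le_of_opNorm_le_of_le (by rwa [norm_star]) le_rfl |>.trans_eq (one_mul _)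

end HilbertSchmidt

section Displacement

/-! ### Displacement operators on Schwartz functions -/

/-- Every derivative has modulus one; this lets displacement phases act as multipliers on Schwartz
functions. -/
theorem hasTemperateGrowth_cexp_I_mul :
    Function.HasTemperateGrowth fun t : ℝ => Complex.exp (Complex.I * (t : ℂ)) := by
  have hd : ∀ k : ℕ, iteratedDeriv k (fun t : ℝ => Complex.exp (Complex.I * (t : ℂ))) =
      fun t : ℝ => Complex.I ^ k * Complex.exp (Complex.I * (t : ℂ)) := by
    intro k
    induction k with
    | zero => simp
    | succ k ih =>
      rw [iteratedDeriv_succ, ih]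
      funext t
      have h : HasDerivAt (fun t : ℝ => Complex.I * (t : ℂ)) Complex.I t := by
        simpa using (Complex.ofRealCLM.hasDerivAt (x := t)).const_mul Complex.I
      rw [(h.cexp.const_mul (Complex.I ^ k)).deriv]
      ring
  refine ⟨(contDiff_const.mul Complex.ofRealCLM.contDiff).cexp, fun k => ⟨0, 1, fun t => ?_⟩⟩
  rw [norm_iteratedFDeriv_eq_norm_iteratedDeriv, hd]
  simp [Complex.norm_exp]

variable {n : ℕ}

theorem hasTemperateGrowth_exp_dispPhase (b : Fin n ⊕ Fin n → ℝ) :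
    Function.HasTemperateGrowth
      fun x : Fin n → ℝ => Complex.exp (Complex.I * (dispPhase b x : ℂ)) := by
  refine hasTemperateGrowth_cexp_I_mul.comp (f := dispPhase b) ?_
  have h : dispPhase b = fun x => (-∑ j, b (Sum.inr j) •
      ContinuousLinearMap.proj (R := ℝ) (φ := fun _ : Fin n => ℝ) j) x - dotXZ b / 2 := by
    funext x
    simp [dispPhase]
  rw [h]
  exact (ContinuousLinearMap.hasTemperateGrowth _).sub (Function.HasTemperateGrowth.const _)

/-- The `X` part of a phase-space vector. -/
def partX {R : Type*} (b : Fin n ⊕ Fin n → R) : Fin n → R := fun j => b (Sum.inl j)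

/-- The displacement operator on Schwartz functions. -/
noncomputable def dispSchwartz (b : Fin n ⊕ Fin n → ℝ) (f : 𝓢(Fin n → ℝ, ℂ)) : 𝓢(Fin n → ℝ, ℂ) :=
  SchwartzMap.smulLeftCLM ℂ (fun x => Complex.exp (Complex.I * (dispPhase b x : ℂ)))
    (SchwartzMap.compSubConstCLM ℂ (-partX b) f)

theorem dispSchwartz_apply (b : Fin n ⊕ Fin n → ℝ) (f : 𝓢(Fin n → ℝ, ℂ)) (x : Fin n → ℝ) :
    dispSchwartz b f x = dispFun b f x := by
  rw [dispSchwartz, SchwartzMap.smulLeftCLM_apply_apply (hasTemperateGrowth_exp_dispPhase b),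
    SchwartzMap.compSubConstCLM_apply, sub_neg_eq_add, dispFun, smul_eq_mul]
  rfl

theorem displacement_toLp (b : Fin n ⊕ Fin n → ℝ) (f : 𝓢(Fin n → ℝ, ℂ)) :
    displacement b (f.toLp 2 volume) = (dispSchwartz b f).toLp 2 volume := by
  refine Lp.ext ((coeFn_displacement b _).trans ?_)
  refine (dispFun_congr b (f.coeFn_toLp 2 volume)).trans ?_
  filter_upwards [(dispSchwartz b f).coeFn_toLp 2 volume] with x hx
  rw [hx, dispSchwartz_apply]

theorem dotXZ_smul {R : Type*} [CommRing R] (s : R) (b : Fin n ⊕ Fin n → R) :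
    dotXZ (s • b) = s ^ 2 * dotXZ b := by
  simp only [dotXZ, Pi.smul_apply, smul_eq_mul, Finset.mul_sum]
  exact Finset.sum_congr rfl fun j _ => by ring

theorem dispPhase_smul (s : ℝ) (b : Fin n ⊕ Fin n → ℝ) (x : Fin n → ℝ) :
    dispPhase (s • b) x = -(s * ∑ j, b (Sum.inr j) * x j) - s ^ 2 * dotXZ b / 2 := by
  rw [dispPhase, dotXZ_smul, Finset.mul_sum]
  simp only [Pi.smul_apply, smul_eq_mul, mul_assoc]

theorem dispFun_smul (s : ℝ) (b : Fin n ⊕ Fin n → ℝ) (f : (Fin n → ℝ) → ℂ) (x : Fin n → ℝ) :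
    dispFun (s • b) f x =
      Complex.exp (Complex.I * (dispPhase (s • b) x : ℂ)) * f (x + s • partX b) := rfl

theorem sum_mul_add_smul_partX (s : ℝ) (b : Fin n ⊕ Fin n → ℝ) (x : Fin n → ℝ) :
    ∑ j, b (Sum.inr j) * (x + s • partX b) j = ∑ j, b (Sum.inr j) * x j + s * dotXZ b := by
  simp only [dotXZ, Finset.mul_sum, ← Finset.sum_add_distrib, Pi.add_apply, Pi.smul_apply,
    smul_eq_mul, partX]
  exact Finset.sum_congr rfl fun j _ => by ring

/-- Displacements compose only up to the phase of a symplectic product, which vanishes for two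
multiples of the same vector; the multiples of `b` thus form a true one-parameter group. -/
theorem dispSchwartz_dispSchwartz (b : Fin n ⊕ Fin n → ℝ) (s t : ℝ) (f : 𝓢(Fin n → ℝ, ℂ)) :
    dispSchwartz (s • b) (dispSchwartz (t • b) f) = dispSchwartz ((s + t) • b) f := by
  ext x
  rw [dispSchwartz_apply, dispFun_smul, dispSchwartz_apply, dispFun_smul, dispSchwartz_apply,
    dispFun_smul, ← mul_assoc, ← Complex.exp_add, dispPhase_smul, dispPhase_smul, dispPhase_smul,
    sum_mul_add_smul_partX, add_assoc, ← add_smul]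
  congr 2
  push_cast
  ring

theorem dispSchwartz_zero (f : 𝓢(Fin n → ℝ, ℂ)) : dispSchwartz 0 f = f := by
  ext x
  rw [dispSchwartz_apply]
  simp [dispFun, dispPhase, dotXZ]
  congr 1
  exact add_zero x

theorem norm_displacement (b : Fin n ⊕ Fin n → ℝ) (ψ : Modes n) : ‖displacement b ψ‖ = ‖ψ‖ := by
  have h : eLpNorm (displacement b ψ) 2 (volume : Measure (Fin n → ℝ)) = eLpNorm ψ 2 volume := by
    rw [← eLpNorm_comp_measurePreserving (Lp.aestronglyMeasurable ψ)
      (measurePreserving_add_right volume (partX b))]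
    refine eLpNorm_congr_norm_ae ?_
    filter_upwards [coeFn_displacement b ψ] with x hx
    rw [hx, dispFun, norm_mul, Complex.norm_exp]
    simp
    rfl
  rw [Lp.norm_def, h, Lp.norm_def]

theorem inner_displacement (b : Fin n ⊕ Fin n → ℝ) (ψ χ : Modes n) :
    inner ℂ (displacement b ψ) (displacement b χ) = inner ℂ ψ χ :=
  LinearIsometry.inner_map_map
    (⟨(displacement b).toLinearMap, norm_displacement b⟩ : Modes n →ₗᵢ[ℂ] Modes n) ψ χ

/-! ### The generator of a one-parameter group of displacements -/

/-- The operator `i bᵀ Ω r̂` on Schwartz functions. -/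
noncomputable def generator (b : Fin n ⊕ Fin n → ℝ) (f : 𝓢(Fin n → ℝ, ℂ)) : 𝓢(Fin n → ℝ, ℂ) :=
  Complex.I • ∑ i, (((b ᵥ* Omega n ℝ) i : ℝ) : ℂ) • quadrature i f

theorem vecMul_Omega_inl (b : Fin n ⊕ Fin n → ℝ) (j : Fin n) :
    (b ᵥ* Omega n ℝ) (Sum.inl j) = -b (Sum.inr j) := by
  simp [Omega, vecMul, dotProduct, Fintype.sum_sum_type, Matrix.one_apply]

theorem vecMul_Omega_inr (b : Fin n ⊕ Fin n → ℝ) (j : Fin n) :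
    (b ᵥ* Omega n ℝ) (Sum.inr j) = b (Sum.inl j) := by
  simp [Omega, vecMul, dotProduct, Fintype.sum_sum_type, Matrix.one_apply]

theorem generator_apply (b : Fin n ⊕ Fin n → ℝ) (f : 𝓢(Fin n → ℝ, ℂ)) (x : Fin n → ℝ) :
    generator b f x = fderiv ℝ f x (partX b) -
      Complex.I * ((∑ j, b (Sum.inr j) * x j : ℝ) : ℂ) * f x := by
  have h : partX b = ∑ j, b (Sum.inl j) • (Pi.single j 1 : Fin n → ℝ) := by
    funext k
    simp [partX, Finset.sum_apply, Pi.single_apply]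
  rw [h, map_sum, generator, _root_.smul_apply, _root_.sum_apply, Fintype.sum_sum_type]
  simp only [_root_.smul_apply, quadrature_inl_apply, quadrature_inr_apply,
    vecMul_Omega_inl, vecMul_Omega_inr, smul_eq_mul, map_smul]
  rw [mul_add, add_comm, sub_eq_add_neg]
  congr 1
  · rw [Finset.mul_sum]
    refine Finset.sum_congr rfl fun j _ => ?_
    rw [f.differentiableAt.lineDeriv_eq_fderiv, Complex.real_smul]
    linear_combination (-(b (Sum.inl j) : ℂ) * fderiv ℝ f x (Pi.single j 1)) * Complex.I_sq
  · push_cast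
    rw [Finset.mul_sum, Finset.mul_sum, Finset.sum_mul, ← Finset.sum_neg_distrib]
    exact Finset.sum_congr rfl fun j _ => by ring

/-- The term of the phase quadratic in s makes its derivative -b_Z·(x + s b_X), which is the
multiplication part of the generator at the shifted point. -/
theorem hasDerivAt_dispFun_smul (b : Fin n ⊕ Fin n → ℝ) (f : 𝓢(Fin n → ℝ, ℂ)) (x : Fin n → ℝ)
    (s : ℝ) :
    HasDerivAt (fun s : ℝ => dispFun (s • b) f x) (dispFun (s • b) (generator b f) x) s := by
  have h1 : HasDerivAt (fun s : ℝ => x + s • partX b) (partX b) s := by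
    simpa using ((hasDerivAt_id s).smul_const (partX b)).const_add x
  have h2 : HasDerivAt (fun s : ℝ => f (x + s • partX b))
      (fderiv ℝ f (x + s • partX b) (partX b)) s :=
    f.differentiableAt.hasFDerivAt.comp_hasDerivAt s h1
  have h3 : HasDerivAt (fun s : ℝ => dispPhase (s • b) x)
      (-∑ j, b (Sum.inr j) * (x + s • partX b) j) s := by
    simp only [dispPhase_smul]
    rw [sum_mul_add_smul_partX]
    refine ((hasDerivAt_mul_const (∑ j, b (Sum.inr j) * x j)).neg.sub
      (((hasDerivAt_pow 2 s).mul_const (dotXZ b)).div_const 2)).congr_deriv ?_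
    push_cast
    ring
  have h4 := (h3.ofReal_comp.const_mul Complex.I).cexp.mul h2
  refine h4.congr_deriv ?_
  rw [dispFun_smul, generator_apply]
  push_cast
  ring

theorem norm_dispFun (b : Fin n ⊕ Fin n → ℝ) (f : (Fin n → ℝ) → ℂ) (x : Fin n → ℝ) :
    ‖dispFun b f x‖ = ‖f (x + partX b)‖ := by
  rw [dispFun, norm_mul, Complex.norm_exp]
  simp
  rfl

/-- A bounded shift changes 1 + ‖x‖ by at most the factor 1 + ‖v‖. The bound, uniform in s, is the
dominating function for the passage from pointwise to L² derivatives. -/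
theorem exists_decay_shift (f : 𝓢(Fin n → ℝ, ℂ)) (v : Fin n → ℝ) (k : ℕ) :
    ∃ C : ℝ, ∀ (x : Fin n → ℝ) (s : ℝ), |s| ≤ 1 →
      ‖f (x + s • v)‖ ≤ C * (1 + ‖x‖) ^ (-(k : ℝ)) := by
  obtain ⟨C, hC⟩ : ∃ C : ℝ, ∀ x, (1 + ‖x‖) ^ k * ‖f x‖ ≤ C := by
    refine ⟨2 ^ k * (Finset.Iic (k, 0)).sup
      (fun m => SchwartzMap.seminorm ℝ (E := Fin n → ℝ) (F := ℂ) m.1 m.2) f, fun x => ?_⟩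
    have := SchwartzMap.one_add_le_sup_seminorm_apply (𝕜 := ℝ) (m := (k, 0)) (k := k) (n := 0)
      le_rfl le_rfl f x
    rwa [norm_iteratedFDeriv_zero] at this
  refine ⟨C * (1 + ‖v‖) ^ k, fun x s hs => ?_⟩
  have hx : 1 + ‖x‖ ≤ (1 + ‖x + s • v‖) * (1 + ‖v‖) := by
    have h1 : ‖x‖ ≤ ‖x + s • v‖ + ‖s • v‖ := by
      simpa using norm_sub_le (x + s • v) (s • v)
    have h2 : ‖s • v‖ ≤ ‖v‖ := by
      rw [norm_smul]
      exact mul_le_of_le_one_left (norm_nonneg v) hs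
    nlinarith [norm_nonneg (x + s • v), norm_nonneg v]
  have h0 : 0 < 1 + ‖x‖ := by positivity
  rw [Real.rpow_neg h0.le, Real.rpow_natCast, ← div_eq_mul_inv, le_div_iff₀ (by positivity)]
  calc ‖f (x + s • v)‖ * (1 + ‖x‖) ^ k
      ≤ ‖f (x + s • v)‖ * ((1 + ‖x + s • v‖) * (1 + ‖v‖)) ^ k := by gcongr
    _ = ((1 + ‖x + s • v‖) ^ k * ‖f (x + s • v)‖) * (1 + ‖v‖) ^ k := by rw [mul_pow]; ring
    _ ≤ C * (1 + ‖v‖) ^ k := by gcongr; exact hC _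

/-- Second-order Taylor estimate by two applications of the mean value inequality; the second
derivative in s is the generator applied twice and then displaced, which leaves its modulus
unchanged up to the shift. -/
theorem norm_dispFun_sub_le (b : Fin n ⊕ Fin n → ℝ) (f : 𝓢(Fin n → ℝ, ℂ)) (x : Fin n → ℝ)
    {M h : ℝ} (hM : ∀ s : ℝ, |s| ≤ |h| → ‖generator b (generator b f) (x + s • partX b)‖ ≤ M) :
    ‖dispFun (h • b) f x - f x - h • generator b f x‖ ≤ M * |h| * |h| := by
  have hconv : Convex ℝ (Metric.closedBall (0 : ℝ) |h|) := convex_closedBall _ _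
  have h0 : (0 : ℝ) ∈ Metric.closedBall (0 : ℝ) |h| := by simp
  have hh : h ∈ Metric.closedBall (0 : ℝ) |h| := by simp
  have hz : ∀ g : 𝓢(Fin n → ℝ, ℂ), dispFun ((0 : ℝ) • b) g x = g x := fun g => by
    rw [zero_smul, ← dispSchwartz_apply, dispSchwartz_zero]
  have h1 : ∀ s ∈ Metric.closedBall (0 : ℝ) |h|,
      ‖dispFun (s • b) (generator b f) x - generator b f x‖ ≤ M * |h| := by
    intro s hs
    have hM0 : 0 ≤ M := (norm_nonneg _).trans (hM 0 (by simp))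
    have := hconv.norm_image_sub_le_of_norm_hasDerivWithin_le
      (f := fun s => dispFun (s • b) (generator b f) x) (C := M)
      (fun t _ => (hasDerivAt_dispFun_smul b (generator b f) x t).hasDerivWithinAt)
      (fun t ht => by
        rw [norm_dispFun]
        exact hM t (by simpa using ht)) h0 hs
    simp only [hz, sub_zero] at this
    refine this.trans ?_
    gcongr
    simpa using hs
  have h2 := hconv.norm_image_sub_le_of_norm_hasDerivWithin_le
      (f := fun s => dispFun (s • b) f x - s • generator b f x) (C := M * |h|)
      (fun t _ => ((hasDerivAt_dispFun_smul b f x t).sub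
        (((hasDerivAt_id t).smul_const (generator b f x)).congr_deriv (one_smul _ _))
        ).hasDerivWithinAt) h1 h0 hh
  simp only [hz, sub_zero, Real.norm_eq_abs] at h2
  rw [zero_smul ℝ (generator b f x), sub_zero] at h2
  refine le_trans (le_of_eq ?_) h2
  congr 1
  ring

/-- The pointwise remainder is at most h² times a fixed square-integrable function, so its L² norm
is o(h). -/
theorem hasDerivAt_dispSchwartz_zero (b : Fin n ⊕ Fin n → ℝ) (f : 𝓢(Fin n → ℝ, ℂ)) :
    HasDerivAt (fun s : ℝ => (dispSchwartz (s • b) f).toLp 2 volume)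
      ((generator b f).toLp 2 volume) 0 := by
  obtain ⟨k, hk⟩ := Measure.HasTemperateGrowth.exists_eLpNorm_lt_top 2
    (inferInstance : (volume : Measure (Fin n → ℝ)).HasTemperateGrowth)
  obtain ⟨C, hC⟩ := exists_decay_shift (generator b (generator b f)) (partX b) k
  have hmem : MemLp (fun x : Fin n → ℝ => (1 + ‖x‖) ^ (-(k : ℝ))) 2 volume :=
    ⟨(Measurable.pow_const (by fun_prop) _).aestronglyMeasurable, hk⟩
  rw [hasDerivAt_iff_isLittleO_nhds_zero]
  refine Asymptotics.IsBigO.trans_isLittleO (g := fun h : ℝ => h ^ 2) ?_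
    (Asymptotics.isLittleO_pow_id one_lt_two)
  refine Asymptotics.IsBigO.of_bound (C * ‖hmem.toLp _‖) ?_
  have hball : Metric.closedBall (0 : ℝ) 1 ∈ nhds (0 : ℝ) := Metric.closedBall_mem_nhds _ one_pos
  filter_upwards [hball] with h hh
  have hh' : |h| ≤ 1 := by simpa using hh
  rw [zero_add, zero_smul, dispSchwartz_zero]
  have key : ‖(dispSchwartz (h • b) f).toLp 2 volume - f.toLp 2 volume -
      h • (generator b f).toLp 2 volume‖ ≤ (C * |h| * |h|) * ‖hmem.toLp _‖ := by
    refine Lp.norm_le_mul_norm_of_ae_le_mul ?_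
    filter_upwards [Lp.coeFn_sub ((dispSchwartz (h • b) f).toLp 2 volume - f.toLp 2 volume)
        (h • (generator b f).toLp 2 volume),
      Lp.coeFn_sub ((dispSchwartz (h • b) f).toLp 2 volume) (f.toLp 2 volume),
      Lp.coeFn_smul h ((generator b f).toLp 2 volume), (dispSchwartz (h • b) f).coeFn_toLp 2 volume,
      f.coeFn_toLp 2 volume, (generator b f).coeFn_toLp 2 volume, hmem.coeFn_toLp]
      with x h1 h2 h3 h4 h5 h6 h7
    rw [h1, Pi.sub_apply, h2, Pi.sub_apply, h3, Pi.smul_apply, h4, h5, h6, h7, dispSchwartz_apply]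
    refine (norm_dispFun_sub_le b f x (M := C * (1 + ‖x‖) ^ (-(k : ℝ)))
      fun s hs => hC x s (hs.trans hh')).trans ?_
    rw [Real.norm_of_nonneg (by positivity)]
    exact le_of_eq (by ring)
  refine key.trans (le_of_eq ?_)
  rw [norm_pow, Real.norm_eq_abs]
  ring

theorem hasDerivAt_dispSchwartz (b : Fin n ⊕ Fin n → ℝ) (f : 𝓢(Fin n → ℝ, ℂ)) (s : ℝ) :
    HasDerivAt (fun s : ℝ => (dispSchwartz (s • b) f).toLp 2 volume)
      ((generator b (dispSchwartz (s • b) f)).toLp 2 volume) s := by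
  have h := hasDerivAt_dispSchwartz_zero b (dispSchwartz (s • b) f)
  rw [← sub_self s] at h
  have h' := h.comp_sub_const s s
  simpa only [dispSchwartz_dispSchwartz, sub_add_cancel] using h'

/-- Skew-symmetry follows by differentiating the constant ⟨D(sb)f, D(sb)g⟩ at s = 0, without
integration by parts. -/
theorem inner_generator_add (b : Fin n ⊕ Fin n → ℝ) (f g : 𝓢(Fin n → ℝ, ℂ)) :
    inner ℂ (f.toLp 2 (volume : Measure (Fin n → ℝ))) ((generator b g).toLp 2 volume) +
      inner ℂ ((generator b f).toLp 2 (volume : Measure (Fin n → ℝ))) (g.toLp 2 volume) = 0 := by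
  have h := (hasDerivAt_dispSchwartz b f 0).inner ℂ (hasDerivAt_dispSchwartz b g 0)
  simp only [← displacement_toLp, inner_displacement, zero_smul, dispSchwartz_zero] at h
  simpa only [displacement_toLp, dispSchwartz_zero] using h.unique (hasDerivAt_const _ _)

/-! ### Covariance of the displacement operators -/

theorem IsGaussianUnitary.apply_generator {S : Matrix (Fin n ⊕ Fin n) (Fin n ⊕ Fin n) ℝ}
    {U : Modes n →L[ℂ] Modes n} (hU : IsGaussianUnitary S U) {b b' : Fin n ⊕ Fin n → ℝ}
    (hb : b' ᵥ* Omega n ℝ = b ᵥ* Omega n ℝ ᵥ* S) (f : 𝓢(Fin n → ℝ, ℂ)) :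
    ∃ g : 𝓢(Fin n → ℝ, ℂ), U (f.toLp 2 volume) = g.toLp 2 volume ∧
      U ((generator b f).toLp 2 volume) = (generator b' g).toLp 2 volume := by
  obtain ⟨g, hg, hq⟩ := hU.quadratures f
  refine ⟨g, hg, ?_⟩
  simp only [← SchwartzMap.toLpCLM_apply (𝕜 := ℂ)] at hq ⊢
  simp only [generator, map_smul, map_sum, hq, hb]
  congr 1
  simp only [Finset.smul_sum, smul_smul]
  rw [Finset.sum_comm]
  refine Finset.sum_congr rfl fun k _ => ?_
  rw [← Finset.sum_smul]
  congr 1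
  simp [vecMul, dotProduct]

theorem dense_schwartz :
    DenseRange fun f : 𝓢(Fin n → ℝ, ℂ) => f.toLp 2 (volume : Measure (Fin n → ℝ)) :=
  SchwartzMap.denseRange_toLpCLM (by simp)

theorem IsGaussianUnitary.mul_displacement {S : Matrix (Fin n ⊕ Fin n) (Fin n ⊕ Fin n) ℝ}
    {U : Modes n →L[ℂ] Modes n} (hU : IsGaussianUnitary S U) {b b' : Fin n ⊕ Fin n → ℝ}
    (hb : b' ᵥ* Omega n ℝ = b ᵥ* Omega n ℝ ᵥ* S) :
    U * displacement b = displacement b' * U := by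
  -- The generator of b passes through U as the generator of b', so the two terms of the product
  -- rule cancel by skew-symmetry.
  have hconst : ∀ (f g : 𝓢(Fin n → ℝ, ℂ)) (s : ℝ),
      HasDerivAt (fun s : ℝ => inner ℂ ((dispSchwartz (s • b') g).toLp 2 volume)
        (U ((dispSchwartz (s • b) f).toLp 2 volume))) 0 s := by
    intro f g s
    obtain ⟨h, hh, hgen⟩ := hU.apply_generator hb (dispSchwartz (s • b) f)
    have hd := (hasDerivAt_dispSchwartz b' g s).inner ℂ
      ((U.restrictScalars ℝ).hasFDerivAt.comp_hasDerivAt s (hasDerivAt_dispSchwartz b f s))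
    refine hd.congr_deriv ?_
    simp only [Function.comp_apply, ContinuousLinearMap.coe_restrictScalars']
    rw [hh, hgen]
    exact inner_generator_add b' _ h
  have hinner : ∀ f g : 𝓢(Fin n → ℝ, ℂ),
      inner ℂ (displacement b' (g.toLp 2 volume)) (U (displacement b (f.toLp 2 volume))) =
        inner ℂ (g.toLp 2 volume) (U (f.toLp 2 volume)) := by
    intro f g
    have h := is_const_of_deriv_eq_zero (fun s => (hconst f g s).differentiableAt)
      (fun s => (hconst f g s).deriv) 1 0
    simpa only [one_smul, zero_smul, dispSchwartz_zero, ← displacement_toLp] using h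
  -- D(b') is onto the Schwartz functions, so it suffices to test against vectors of the form
  -- D(b')g.
  have hsurj : ∀ g : 𝓢(Fin n → ℝ, ℂ),
      g.toLp 2 volume = displacement b' ((dispSchwartz (-b') g).toLp 2 volume) := by
    intro g
    have h := dispSchwartz_dispSchwartz b' 1 (-1) g
    rw [add_neg_cancel, zero_smul, one_smul, neg_one_smul, dispSchwartz_zero] at h
    rw [displacement_toLp, h]
  refine ContinuousLinearMap.ext fun ψ => ?_
  refine congrFun (dense_schwartz.equalizer (U * displacement b).continuous
    (displacement b' * U).continuous (funext fun f => ?_)) ψ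
  refine dense_schwartz.eq_of_inner_right ℂ fun g => ?_
  change inner ℂ (g.toLp 2 volume) (U (displacement b (f.toLp 2 volume))) =
    inner ℂ (g.toLp 2 volume) (displacement b' (U (f.toLp 2 volume)))
  rw [hsurj g, hinner, inner_displacement]

end Displacement

section Symplectic

/-! ### Integer symplectic matrices -/

variable {n : ℕ}

theorem Omega_eq_neg_J (R : Type*) [CommRing R] : Omega n R = -Matrix.J (Fin n) R := by
  simp [Omega, Matrix.J, Matrix.fromBlocks_neg]

theorem Omega_mul_Omega (R : Type*) [CommRing R] : Omega n R * Omega n R = -1 := by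
  rw [Omega_eq_neg_J, neg_mul_neg, Matrix.J_squared]

theorem Omega_inv (R : Type*) [CommRing R] : (Omega n R)⁻¹ = -Omega n R := by
  refine Matrix.inv_eq_right_inv ?_
  rw [mul_neg, Omega_mul_Omega, neg_neg]

theorem transpose_mul_Omega_mul {R : Type*} [CommRing R]
    {S : Matrix (Fin n ⊕ Fin n) (Fin n ⊕ Fin n) R} (hS : S ∈ Matrix.symplecticGroup (Fin n) R) :
    Sᵀ * Omega n R * S = Omega n R := by
  rw [Omega_eq_neg_J, mul_neg, neg_mul, SymplecticGroup.mem_iff'.1 hS]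

theorem realMat_mem_symplecticGroup {S : Matrix (Fin n ⊕ Fin n) (Fin n ⊕ Fin n) ℤ}
    (hS : S ∈ Matrix.symplecticGroup (Fin n) ℤ) :
    realMat S ∈ Matrix.symplecticGroup (Fin n) ℝ := by
  have h := SymplecticGroup.map_mem (S := ℝ) hS (Int.castRingHom ℝ)
  exact h

theorem realMat_mulVec_realVec (S : Matrix (Fin n ⊕ Fin n) (Fin n ⊕ Fin n) ℤ)
    (a : Fin n ⊕ Fin n → ℤ) : realMat S *ᵥ realVec a = realVec (S *ᵥ a) := by
  funext i
  simp [realMat, realVec, mulVec, dotProduct]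

theorem sympl_mulVec_mulVec {S : Matrix (Fin n ⊕ Fin n) (Fin n ⊕ Fin n) ℝ}
    (hS : S ∈ Matrix.symplecticGroup (Fin n) ℝ) (a b : Fin n ⊕ Fin n → ℝ) :
    sympl (S *ᵥ a) (S *ᵥ b) = sympl a b := by
  rw [sympl, sympl, Matrix.mulVec_mulVec, Matrix.dotProduct_mulVec, Matrix.vecMul_mulVec,
    ← Matrix.dotProduct_mulVec, ← Matrix.mul_assoc, transpose_mul_Omega_mul hS]

theorem dotProduct_Omega_mulVec {R : Type*} [CommRing R] (a b : Fin n ⊕ Fin n → R) :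
    a ⬝ᵥ (Omega n R *ᵥ b) =
      ∑ j, (a (Sum.inl j) * b (Sum.inr j) - a (Sum.inr j) * b (Sum.inl j)) := by
  have h1 : ∀ j, (Omega n R *ᵥ b) (Sum.inl j) = b (Sum.inr j) := fun j => by
    simp [Omega, mulVec, dotProduct, Fintype.sum_sum_type, Matrix.one_apply]
  have h2 : ∀ j, (Omega n R *ᵥ b) (Sum.inr j) = -b (Sum.inl j) := fun j => by
    simp [Omega, mulVec, dotProduct, Fintype.sum_sum_type, Matrix.one_apply]
  simp only [dotProduct, Fintype.sum_sum_type, h1, h2, mul_neg, Finset.sum_neg_distrib,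
    sub_eq_add_neg, Finset.sum_add_distrib]

theorem sympl_realVec (a b : Fin n ⊕ Fin n → ℤ) :
    sympl (realVec a) (realVec b) = ((a ⬝ᵥ (Omega n ℤ *ᵥ b) : ℤ) : ℝ) := by
  rw [sympl, dotProduct_Omega_mulVec, dotProduct_Omega_mulVec]
  simp [realVec]

/-- [Sa, SΩ⁻¹t̄] = [a, Ω⁻¹t̄] = a·t̄. This explains the form of the shift: it represents a ↦ a·t̄ as
a symplectic product with Sa. -/
theorem dotProduct_Omega_shiftCoeff {S : Matrix (Fin n ⊕ Fin n) (Fin n ⊕ Fin n) ℤ}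
    (hS : S ∈ Matrix.symplecticGroup (Fin n) ℤ) (a : Fin n ⊕ Fin n → ℤ) :
    (S *ᵥ a) ⬝ᵥ (Omega n ℤ *ᵥ shiftCoeff S) = a ⬝ᵥ tbar S := by
  rw [shiftCoeff, Matrix.mulVec_mulVec, Matrix.dotProduct_mulVec, Matrix.vecMul_mulVec,
    ← Matrix.mul_assoc, ← Matrix.mul_assoc, transpose_mul_Omega_mul hS, Omega_inv, mul_neg,
    Omega_mul_Omega, neg_neg, ← Matrix.dotProduct_mulVec, Matrix.one_mulVec]

/-- A quadratic form with symmetric matrix is linear modulo two. -/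
theorem even_dotProduct_mulVec_sub {ι : Type*} [Fintype ι] [DecidableEq ι] {M : Matrix ι ι ℤ}
    (hM : M.IsSymm) (x : ι → ℤ) : Even (x ⬝ᵥ (M *ᵥ x) - x ⬝ᵥ M.diag) := by
  have hsq : ∀ t : ZMod 2, t * t = t := by decide
  have hadd : ∀ t : ZMod 2, t + t = 0 := by decide
  rw [even_iff_two_dvd]
  refine (ZMod.intCast_zmod_eq_zero_iff_dvd _ 2).1 ?_
  -- Off the diagonal, the entries at (i, j) and (j, i) are equal by symmetry and cancel in `ZMod
  -- 2`. On the diagonal, t² = t makes the form linear.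
  let F : ι × ι → ZMod 2 := fun p => if p.1 = p.2 then 0 else x p.1 * M p.1 p.2 * x p.2
  have hF : ∑ p, F p = 0 := by
    refine Finset.sum_involution (fun p _ => p.swap) (fun p _ => ?_) (fun p _ hp h => hp ?_)
      (fun _ _ => Finset.mem_univ _) (fun p _ => p.swap_swap)
    · simp only [F, Prod.fst_swap, Prod.snd_swap, eq_comm (a := p.2)]
      split_ifs
      · simp
      · rw [hM.apply p.1 p.2, mul_comm, ← mul_assoc, mul_right_comm, hadd]
    · simp only [F]
      exact if_pos (congrArg Prod.snd h : p.1 = p.2)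
  have hx : ((x ⬝ᵥ (M *ᵥ x) : ℤ) : ZMod 2) =
      ∑ p : ι × ι, (F p + if p.1 = p.2 then ((x p.1 * M p.1 p.1 : ℤ) : ZMod 2) else 0) := by
    rw [Fintype.sum_prod_type]
    simp only [dotProduct, mulVec, Finset.mul_sum, Int.cast_sum]
    refine Finset.sum_congr rfl fun i _ => Finset.sum_congr rfl fun j _ => ?_
    by_cases h : i = j
    · subst h
      simp only [F, if_true, zero_add]
      push_cast
      rw [mul_left_comm, hsq, mul_comm]
    · simp only [F, h, if_false, add_zero]
      push_cast
      ring
  rw [Int.cast_sub, hx, Finset.sum_add_distrib, hF, zero_add, Fintype.sum_prod_type]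
  simp [dotProduct]

/-- With a = (x, z), expanding (Ax + Bz)·(Cx + Dz) gives the forms of AᵀC and BᵀD, linear modulo 2,
and the cross term x·(AᵀD + CᵀB)z. Since AᵀD - CᵀB = 1, the cross term is 2 x·AᵀDz - x·z, congruent
to x·z. -/
theorem even_dotXZ_mulVec_sub {S : Matrix (Fin n ⊕ Fin n) (Fin n ⊕ Fin n) ℤ}
    (hS : S ∈ Matrix.symplecticGroup (Fin n) ℤ) (a : Fin n ⊕ Fin n → ℤ) :
    Even (dotXZ (S *ᵥ a) - dotXZ a - a ⬝ᵥ tbar S) := by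
  rw [← Matrix.fromBlocks_toBlocks S] at hS
  obtain ⟨h1, h2, h3⟩ := SymplecticGroup.fromBlocks_mem_iff.1 hS
  have hM1 : (S.toBlocks₁₁ᵀ * S.toBlocks₂₁).IsSymm := by
    rw [Matrix.IsSymm, Matrix.transpose_mul, Matrix.transpose_transpose, h1]
  have hM2 : (S.toBlocks₁₂ᵀ * S.toBlocks₂₂).IsSymm := by
    rw [Matrix.IsSymm, Matrix.transpose_mul, Matrix.transpose_transpose, h2]
  have htbar : a ⬝ᵥ tbar S =
      (a ∘ Sum.inl) ⬝ᵥ (S.toBlocks₁₁ᵀ * S.toBlocks₂₁).diag +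
        (a ∘ Sum.inr) ⬝ᵥ (S.toBlocks₁₂ᵀ * S.toBlocks₂₂).diag := by
    simp [dotProduct, Fintype.sum_sum_type, tbar]
  have hdot : ∀ v : Fin n ⊕ Fin n → ℤ, dotXZ v = (v ∘ Sum.inl) ⬝ᵥ (v ∘ Sum.inr) := fun v => rfl
  have h3' := congrArg (fun M => (a ∘ Sum.inl) ⬝ᵥ (M *ᵥ (a ∘ Sum.inr))) h3
  have hSa : S *ᵥ a = Sum.elim
      (S.toBlocks₁₁ *ᵥ (a ∘ Sum.inl) + S.toBlocks₁₂ *ᵥ (a ∘ Sum.inr))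
      (S.toBlocks₂₁ *ᵥ (a ∘ Sum.inl) + S.toBlocks₂₂ *ᵥ (a ∘ Sum.inr)) := by
    conv_lhs => rw [← Matrix.fromBlocks_toBlocks S, Matrix.fromBlocks_mulVec]
  rw [htbar, hdot, hdot, hSa, Sum.elim_comp_inl, Sum.elim_comp_inr]
  generalize a ∘ Sum.inl = x at *
  generalize a ∘ Sum.inr = z at *
  obtain ⟨p, hp⟩ := even_dotProduct_mulVec_sub hM1 x
  obtain ⟨q, hq⟩ := even_dotProduct_mulVec_sub hM2 z
  have hcross : z ⬝ᵥ ((S.toBlocks₁₂ᵀ * S.toBlocks₂₁) *ᵥ x) =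
      x ⬝ᵥ ((S.toBlocks₂₁ᵀ * S.toBlocks₁₂) *ᵥ z) := by
    rw [Matrix.dotProduct_mulVec x, ← Matrix.mulVec_transpose, Matrix.transpose_mul,
      Matrix.transpose_transpose, dotProduct_comm]
  simp only [Matrix.sub_mulVec, Matrix.one_mulVec, dotProduct_sub] at h3'
  have hexp : ∀ (M N : Matrix (Fin n) (Fin n) ℤ) (u v : Fin n → ℤ),
      (M *ᵥ u) ⬝ᵥ (N *ᵥ v) = u ⬝ᵥ ((Mᵀ * N) *ᵥ v) := by
    intro M N u v
    rw [← Matrix.mulVec_mulVec, Matrix.dotProduct_mulVec u, ← Matrix.mulVec_transpose,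
      Matrix.transpose_transpose]
  rw [add_dotProduct, dotProduct_add, dotProduct_add, hexp, hexp, hexp, hexp, hcross]
  exact ⟨p + q + x ⬝ᵥ ((S.toBlocks₁₁ᵀ * S.toBlocks₂₂) *ᵥ z) - x ⬝ᵥ z, by linarith⟩

/-! ### Covariance of the terms of the Wigner function -/

theorem ell_pos {d : ℕ} (hd : 0 < d) : 0 < ell d := by
  unfold ell
  positivity

theorem IsGaussianUnitary.star_mul_logicalShift_mul
    {S : Matrix (Fin n ⊕ Fin n) (Fin n ⊕ Fin n) ℤ} (hS : S ∈ Matrix.symplecticGroup (Fin n) ℤ)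
    {U : Modes n →L[ℂ] Modes n} (hU : IsGaussianUnitary (realMat S) U) (d : ℕ)
    (a : Fin n ⊕ Fin n → ℤ) :
    star U * logicalShift d (realVec a) * U = logicalShift d (realVec (S *ᵥ a)) := by
  have h := hU.mul_displacement (b := -(ell d • realVec (S *ᵥ a))) (b' := -(ell d • realVec a)) (by
    rw [← realMat_mulVec_realVec, ← smul_neg, ← smul_neg, Matrix.smul_vecMul, Matrix.smul_vecMul,
      Matrix.smul_vecMul, ← Matrix.mulVec_neg, Matrix.vecMul_mulVec,
      Matrix.vecMul_vecMul, transpose_mul_Omega_mul (realMat_mem_symplecticGroup hS)])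
  rw [logicalShift, logicalShift, mul_assoc, ← h, ← mul_assoc,
    Unitary.star_mul_self_of_mem hU.unitary, one_mul]

theorem opTrace_mul_logicalShift {S : Matrix (Fin n ⊕ Fin n) (Fin n ⊕ Fin n) ℤ}
    (hS : S ∈ Matrix.symplecticGroup (Fin n) ℤ) {U : Modes n →L[ℂ] Modes n}
    (hU : IsGaussianUnitary (realMat S) U) {ρ : Modes n →L[ℂ] Modes n} (hρ : IsDensityOperator ρ)
    (d : ℕ) (a : Fin n ⊕ Fin n → ℤ) :
    opTrace (U * ρ * star U * logicalShift d (realVec a)) =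
      opTrace (ρ * logicalShift d (realVec (S *ᵥ a))) := by
  rw [← hU.star_mul_logicalShift_mul hS, ← opTrace_conj hρ hU.unitary]
  congr 1
  simp only [mul_assoc, Unitary.mul_star_self_of_mem hU.unitary, mul_one]

theorem exp_phase_eq {d : ℕ} (hd : 0 < d) {S : Matrix (Fin n ⊕ Fin n) (Fin n ⊕ Fin n) ℤ}
    (hS : S ∈ Matrix.symplecticGroup (Fin n) ℤ) (η : Fin n ⊕ Fin n → ℝ) (a : Fin n ⊕ Fin n → ℤ) :
    Complex.exp (Complex.I * ((ell d * sympl (realVec a) η : ℝ) : ℂ)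
        + Complex.I * Real.pi * ((dotXZ a : ℤ) : ℂ)) =
      Complex.exp (Complex.I * ((ell d * sympl (realVec (S *ᵥ a))
          (realMat S *ᵥ η - shift d S) : ℝ) : ℂ)
        + Complex.I * Real.pi * ((dotXZ (S *ᵥ a) : ℤ) : ℂ)) := by
  obtain ⟨m, hm⟩ := even_dotXZ_mulVec_sub hS a
  have h1 : sympl (realVec (S *ᵥ a)) (realMat S *ᵥ η - shift d S) =
      sympl (realVec a) η - Real.pi / ell d * ((a ⬝ᵥ tbar S : ℤ) : ℝ) := by
    have h2 : sympl (realVec (S *ᵥ a)) (realMat S *ᵥ η) = sympl (realVec a) η := by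
      rw [← realMat_mulVec_realVec, sympl_mulVec_mulVec (realMat_mem_symplecticGroup hS)]
    have h3 : sympl (realVec (S *ᵥ a)) (shift d S) =
        Real.pi / ell d * ((a ⬝ᵥ tbar S : ℤ) : ℝ) := by
      rw [← dotProduct_Omega_shiftCoeff hS a, ← sympl_realVec, shift, sympl, sympl,
        Matrix.mulVec_smul, dotProduct_smul, smul_eq_mul]
    rw [← h2, ← h3]
    simp only [sympl, Matrix.mulVec_sub, dotProduct_sub]
  have hq : dotXZ (S *ᵥ a) = dotXZ a + a ⬝ᵥ tbar S + 2 * m := by linarith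
  rw [h1, hq, Complex.exp_eq_exp_iff_exists_int]
  -- The shift cancels π a·t̄, and the remaining even part 2m of the parity difference is a full
  -- period.
  refine ⟨-m, ?_⟩
  have hell : ((ell d : ℝ) : ℂ) ≠ 0 := Complex.ofReal_ne_zero.2 (ell_pos hd).ne'
  push_cast
  field_simp
  ring

theorem wignerTerm_conj {d : ℕ} (hd : 0 < d) {S : Matrix (Fin n ⊕ Fin n) (Fin n ⊕ Fin n) ℤ}
    (hS : S ∈ Matrix.symplecticGroup (Fin n) ℤ) {U : Modes n →L[ℂ] Modes n}
    (hU : IsGaussianUnitary (realMat S) U) {ρ : Modes n →L[ℂ] Modes n} (hρ : IsDensityOperator ρ)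
    (η : Fin n ⊕ Fin n → ℝ) (a : Fin n ⊕ Fin n → ℤ) :
    wignerTerm d (U * ρ * star U) η a =
      wignerTerm d ρ (realMat S *ᵥ η - shift d S) (S *ᵥ a) := by
  rw [wignerTerm, wignerTerm, opTrace_mul_logicalShift hS hU hρ, exp_phase_eq hd hS]

/-- The action of an integer symplectic matrix on the index lattice. -/
noncomputable def latticeEquiv (S : Matrix (Fin n ⊕ Fin n) (Fin n ⊕ Fin n) ℤ)
    (hS : S ∈ Matrix.symplecticGroup (Fin n) ℤ) : (Fin n ⊕ Fin n → ℤ) ≃ (Fin n ⊕ Fin n → ℤ) where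
  toFun a := S *ᵥ a
  invFun a := S⁻¹ *ᵥ a
  left_inv a := by
    beta_reduce
    rw [Matrix.mulVec_mulVec, Matrix.nonsing_inv_mul _ (SymplecticGroup.symplectic_det hS),
      Matrix.one_mulVec]
  right_inv a := by
    beta_reduce
    rw [Matrix.mulVec_mulVec, Matrix.mul_nonsing_inv _ (SymplecticGroup.symplectic_det hS),
      Matrix.one_mulVec]

theorem wignerTerm_conj_eq_comp {d : ℕ} (hd : 0 < d)
    {S : Matrix (Fin n ⊕ Fin n) (Fin n ⊕ Fin n) ℤ}
    (hS : S ∈ Matrix.symplecticGroup (Fin n) ℤ) {U : Modes n →L[ℂ] Modes n}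
    (hU : IsGaussianUnitary (realMat S) U) {ρ : Modes n →L[ℂ] Modes n} (hρ : IsDensityOperator ρ)
    (η : Fin n ⊕ Fin n → ℝ) :
    wignerTerm d (U * ρ * star U) η =
      wignerTerm d ρ (realMat S *ᵥ η - shift d S) ∘ latticeEquiv S hS :=
  funext fun a => wignerTerm_conj hd hS hU hρ η a

/-- Pure reindexing; where the series diverge, both `tsum`s take the default value, so the equation
needs no summability. -/
theorem zakGrossWigner_conj {d : ℕ} (hd : 0 < d) {S : Matrix (Fin n ⊕ Fin n) (Fin n ⊕ Fin n) ℤ}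
    (hS : S ∈ Matrix.symplecticGroup (Fin n) ℤ) {U : Modes n →L[ℂ] Modes n}
    (hU : IsGaussianUnitary (realMat S) U) {ρ : Modes n →L[ℂ] Modes n} (hρ : IsDensityOperator ρ)
    (η : Fin n ⊕ Fin n → ℝ) :
    (Summable (wignerTerm d (U * ρ * star U) η) ↔
        Summable (wignerTerm d ρ (realMat S *ᵥ η - shift d S))) ∧
      zakGrossWigner d (U * ρ * star U) η = zakGrossWigner d ρ (realMat S *ᵥ η - shift d S) := by
  rw [zakGrossWigner, zakGrossWigner, wignerTerm_conj_eq_comp hd hS hU hρ]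
  exact ⟨(latticeEquiv S hS).summable_iff, (latticeEquiv S hS).tsum_eq _⟩

end Symplectic

section Smeared

/-! ### Convergence of the smeared series -/

open scoped FourierTransform in
/-- Fourier integrals of Schwartz functions decay rapidly. -/
theorem exists_norm_pow_mul_fourierIntegral_le {ι : Type*} [Fintype ι] (φ : 𝓢(ι → ℝ, ℂ)) (k : ℕ) :
    ∃ C : ℝ, ∀ w : ι → ℝ,
      ‖w‖ ^ k * ‖∫ η, Complex.exp (((-2 * Real.pi * (w ⬝ᵥ η) : ℝ) : ℂ) * Complex.I) * φ η‖ ≤ C := by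
  -- The Fourier transform is taken on Euclidean space; its norm dominates the sup norm of `ι → ℝ`,
  -- so the decay bound transfers.
  let φ' : 𝓢(EuclideanSpace ℝ ι, ℂ) :=
    SchwartzMap.compCLMOfContinuousLinearEquiv ℝ (EuclideanSpace.equiv ι ℝ) φ
  obtain ⟨C, -, hC⟩ := (𝓕 φ').decay k 0
  refine ⟨C, fun w => ?_⟩
  have h := hC (WithLp.toLp 2 w)
  rw [norm_iteratedFDeriv_zero, SchwartzMap.fourier_coe, Real.fourier_eq'] at h
  have hint : ∫ v : EuclideanSpace ℝ ι, Complex.exp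
        (((-2 * Real.pi * inner ℝ v (WithLp.toLp 2 w) : ℝ) : ℂ) * Complex.I) • φ' v =
      ∫ η, Complex.exp (((-2 * Real.pi * (w ⬝ᵥ η) : ℝ) : ℂ) * Complex.I) * φ η := by
    rw [← (PiLp.volume_preserving_toLp ι).integral_comp
      (MeasurableEquiv.toLp 2 (ι → ℝ)).measurableEmbedding]
    rfl
  rw [hint] at h
  refine le_trans ?_ h
  gcongr
  exact (pi_norm_le_iff_of_nonneg (norm_nonneg _)).2 fun i => PiLp.norm_apply_le (WithLp.toLp 2 w) i

/-- ℤ^ι is a lattice, and exponents beyond its rank give convergence. -/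
theorem exists_summable_norm_intCast_inv_pow (ι : Type*) [Fintype ι] :
    ∃ k : ℕ, Summable fun m : ι → ℤ => ‖fun i => (m i : ℝ)‖⁻¹ ^ k := by
  classical
  let L := Submodule.span ℤ (Set.range (Pi.basisFun ℝ ι))
  have hmem : ∀ m : ι → ℤ, (fun i => (m i : ℝ)) ∈ L := by
    intro m
    have h : (fun i => (m i : ℝ)) = ∑ i, m i • Pi.basisFun ℝ ι i := by
      funext j
      simp [Finset.sum_apply, Pi.single_apply]
    rw [h]
    exact Submodule.sum_mem _ fun i _ => Submodule.smul_mem _ _ (Submodule.subset_span ⟨i, rfl⟩)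
  refine ⟨Module.finrank ℤ L + 1, ?_⟩
  have hinj : Function.Injective fun m : ι → ℤ => (⟨fun i => (m i : ℝ), hmem m⟩ : L) := by
    intro m m' h
    funext i
    exact Int.cast_injective (congrFun (congrArg Subtype.val h) i)
  have h : Summable fun z : L => ‖(z : ι → ℝ)‖⁻¹ ^ (Module.finrank ℤ L + 1) :=
    ZLattice.summable_norm_pow_inv L (Module.finrank ℤ L + 1) (Nat.lt_succ_self _)
  have h' := h.comp_injective hinj
  simpa only [Function.comp_def] using h'

theorem summable_fourierIntegral {ι : Type*} [Fintype ι] (φ : 𝓢(ι → ℝ, ℂ)) {c : ℝ} (hc : c ≠ 0) :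
    Summable fun m : ι → ℤ =>
      ‖∫ η, Complex.exp (Complex.I * ((c * ((fun i => (m i : ℝ)) ⬝ᵥ η) : ℝ) : ℂ)) * φ η‖ := by
  obtain ⟨k, hk⟩ := exists_summable_norm_intCast_inv_pow ι
  obtain ⟨C, hC⟩ := exists_norm_pow_mul_fourierIntegral_le φ k
  -- Chosen so that the Fourier phase -2π(s m)·η equals c m·η.
  let s : ℝ := -c / (2 * Real.pi)
  have hs : 0 < |s| := abs_pos.2 (div_ne_zero (neg_ne_zero.2 hc) (by positivity))
  refine Summable.of_norm_bounded_eventually (hk.mul_left (C / |s| ^ k)) ?_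
  -- The decay bound is divided by a power of ‖m‖, so the origin is left out.
  filter_upwards [(Set.finite_singleton (0 : ι → ℤ)).compl_mem_cofinite] with m hm
  have hm0 : 0 < ‖fun i => (m i : ℝ)‖ := by
    rw [norm_pos_iff]
    intro h
    exact hm (funext fun i => Int.cast_injective (α := ℝ) (by simpa using congrFun h i))
  have h := hC (s • fun i => (m i : ℝ))
  have hphase : ∀ η : ι → ℝ,
      ((-2 * Real.pi * ((s • fun i => (m i : ℝ)) ⬝ᵥ η) : ℝ) : ℂ) * Complex.I =
      Complex.I * ((c * ((fun i => (m i : ℝ)) ⬝ᵥ η) : ℝ) : ℂ) := by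
    intro η
    rw [smul_dotProduct, smul_eq_mul, mul_comm Complex.I]
    congr 2
    simp only [s]
    field_simp
  simp only [hphase] at h
  rw [norm_smul, mul_pow, Real.norm_eq_abs s] at h
  rw [norm_norm, inv_pow, ← div_eq_mul_inv, div_div, le_div_iff₀ (by positivity), mul_comm]
  exact h

variable {n : ℕ}

theorem norm_displacement_le_one (b : Fin n ⊕ Fin n → ℝ) : ‖displacement b‖ ≤ 1 :=
  ContinuousLinearMap.opNorm_le_bound _ zero_le_one fun ψ => by
    rw [norm_displacement, one_mul]

/-- Each term is a unimodular constant times a trace of modulus at most 1 times the Fourier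
coefficient of φ at ℓ aᵀΩ, up to (2π)⁻ⁿ. Since Ω² = -1, the map a ↦ aᵀΩ is injective. -/
theorem summable_smearedTerm {d : ℕ} (hd : 0 < d) {ρ : Modes n →L[ℂ] Modes n}
    (hρ : IsDensityOperator ρ) (φ : 𝓢(Fin n ⊕ Fin n → ℝ, ℂ)) : Summable (smearedTerm d ρ φ) := by
  have h := (summable_fourierIntegral φ (ell_pos hd).ne').comp_injective
    (i := fun a : Fin n ⊕ Fin n → ℤ => a ᵥ* Omega n ℤ) (by
      intro a a' h
      have h' := congrArg (fun v => v ᵥ* Omega n ℤ) h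
      simpa [Matrix.vecMul_vecMul, Omega_mul_Omega, Matrix.vecMul_neg] using h')
  refine Summable.of_norm_bounded (h.mul_left ‖(1 / (2 * Real.pi) ^ n : ℂ)‖) fun a => ?_
  have hphase : ∀ η : Fin n ⊕ Fin n → ℝ,
      (fun i => ((a ᵥ* Omega n ℤ) i : ℝ)) ⬝ᵥ η = sympl (realVec a) η := by
    intro η
    rw [sympl, Matrix.dotProduct_mulVec]
    congr 1
    have h1 : Omega n ℝ = realMat (Omega n ℤ) := by
      rw [realMat, Omega, Omega, Matrix.fromBlocks_map]
      simp [Matrix.map_one, Matrix.map_neg]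
    funext i
    rw [h1]
    simp [vecMul, dotProduct, realVec, realMat]
  have hterm : ∀ η, wignerTerm d ρ η a * φ η =
      ((1 / (2 * Real.pi) ^ n : ℂ) * Complex.exp (Complex.I * Real.pi * ((dotXZ a : ℤ) : ℂ)) *
        opTrace (ρ * logicalShift d (realVec a))) *
      (Complex.exp (Complex.I * ((ell d * sympl (realVec a) η : ℝ) : ℂ)) * φ η) := by
    intro η
    rw [wignerTerm, Complex.exp_add]
    ring
  have hexp : ‖Complex.exp (Complex.I * Real.pi * ((dotXZ a : ℤ) : ℂ))‖ = 1 := by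
    rw [Complex.norm_exp]
    simp
  simp only [smearedTerm, hterm, Function.comp_apply, hphase]
  rw [integral_const_mul, norm_mul, norm_mul, norm_mul, hexp, mul_one]
  gcongr
  exact mul_le_of_le_one_right (norm_nonneg _)
    (norm_opTrace_mul_le hρ (norm_displacement_le_one _))

/-! ### Covariance of the smeared Wigner function -/

theorem realMat_inv_mul {S : Matrix (Fin n ⊕ Fin n) (Fin n ⊕ Fin n) ℤ}
    (hS : S ∈ Matrix.symplecticGroup (Fin n) ℤ) : (realMat S)⁻¹ * realMat S = 1 :=
  Matrix.nonsing_inv_mul _ (SymplecticGroup.symplectic_det (realMat_mem_symplecticGroup hS))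

theorem realMat_mul_inv {S : Matrix (Fin n ⊕ Fin n) (Fin n ⊕ Fin n) ℤ}
    (hS : S ∈ Matrix.symplecticGroup (Fin n) ℤ) : realMat S * (realMat S)⁻¹ = 1 :=
  Matrix.mul_nonsing_inv _ (SymplecticGroup.symplectic_det (realMat_mem_symplecticGroup hS))

/-- Symplectic matrices have determinant one, and Lebesgue measure is translation invariant. -/
theorem integral_comp_mulVec_sub {S : Matrix (Fin n ⊕ Fin n) (Fin n ⊕ Fin n) ℝ}
    (hS : S ∈ Matrix.symplecticGroup (Fin n) ℝ) (t : Fin n ⊕ Fin n → ℝ)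
    (F : (Fin n ⊕ Fin n → ℝ) → ℂ) : ∫ η, F (S *ᵥ η - t) = ∫ ξ, F ξ := by
  have hdet := SymplecticGroup.det_eq_one hS
  have hmp : MeasurePreserving (Matrix.toLin' S) volume volume := by
    refine ⟨(LinearMap.continuous_of_finiteDimensional _).measurable, ?_⟩
    rw [Real.map_matrix_volume_pi_eq_smul_volume_pi (by rw [hdet]; exact one_ne_zero), hdet]
    simp
  have hemb : MeasurableEmbedding (Matrix.toLin' S) := by
    refine (LinearMap.continuous_of_finiteDimensional _).measurableEmbedding ?_
    rw [Matrix.toLin'_apply']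
    exact Matrix.mulVec_injective_of_isUnit
      ((Matrix.isUnit_iff_isUnit_det _).2 (SymplecticGroup.symplectic_det hS))
  have h := hmp.integral_comp hemb fun ξ => F (ξ - t)
  simp only [Matrix.toLin'_apply] at h
  rw [h, integral_sub_right_eq_self]

theorem exists_schwartz_comp {S : Matrix (Fin n ⊕ Fin n) (Fin n ⊕ Fin n) ℤ}
    (hS : S ∈ Matrix.symplecticGroup (Fin n) ℤ) (t : Fin n ⊕ Fin n → ℝ)
    (φ : 𝓢(Fin n ⊕ Fin n → ℝ, ℂ)) :
    ∃ ψ : 𝓢(Fin n ⊕ Fin n → ℝ, ℂ), (fun ξ => φ ((realMat S)⁻¹ *ᵥ (ξ + t))) = ψ := by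
  let e := (Matrix.toLin'OfInv (realMat_mul_inv hS) (realMat_inv_mul hS)).toContinuousLinearEquiv
  refine ⟨SchwartzMap.compSubConstCLM ℝ (-t)
    (SchwartzMap.compCLMOfContinuousLinearEquiv ℝ e φ), funext fun ξ => ?_⟩
  rw [SchwartzMap.compSubConstCLM_apply, sub_neg_eq_add]
  rfl

/-- The change of variables ξ = Sη - t in each term, followed by reindexing the lattice. The
transported test function is again Schwartz, which gives convergence. -/
theorem smearedWigner_conj {d : ℕ} (hd : 0 < d) {S : Matrix (Fin n ⊕ Fin n) (Fin n ⊕ Fin n) ℤ}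
    (hS : S ∈ Matrix.symplecticGroup (Fin n) ℤ) {U : Modes n →L[ℂ] Modes n}
    (hU : IsGaussianUnitary (realMat S) U) {ρ : Modes n →L[ℂ] Modes n} (hρ : IsDensityOperator ρ)
    (φ : 𝓢(Fin n ⊕ Fin n → ℝ, ℂ)) :
    Summable (smearedTerm d (U * ρ * star U) φ) ∧
      Summable (smearedTerm d ρ (fun ξ => φ ((realMat S)⁻¹ *ᵥ (ξ + shift d S)))) ∧
      smearedWigner d (U * ρ * star U) φ =
        smearedWigner d ρ (fun ξ => φ ((realMat S)⁻¹ *ᵥ (ξ + shift d S))) := by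
  have hterm : smearedTerm d (U * ρ * star U) φ =
      smearedTerm d ρ (fun ξ => φ ((realMat S)⁻¹ *ᵥ (ξ + shift d S))) ∘ latticeEquiv S hS := by
    funext a
    rw [Function.comp_apply, smearedTerm, smearedTerm]
    refine Eq.trans ?_
      (integral_comp_mulVec_sub (realMat_mem_symplecticGroup hS) (shift d S) _)
    refine integral_congr_ae (Filter.Eventually.of_forall fun η => ?_)
    beta_reduce
    rw [wignerTerm_conj hd hS hU hρ, sub_add_cancel, Matrix.mulVec_mulVec, realMat_inv_mul hS,
      Matrix.one_mulVec]
    rfl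
  have hsum : Summable (smearedTerm d ρ (fun ξ => φ ((realMat S)⁻¹ *ᵥ (ξ + shift d S)))) := by
    obtain ⟨ψ, hψ⟩ := exists_schwartz_comp hS (shift d S) φ
    rw [hψ]
    exact summable_smearedTerm hd hρ ψ
  refine ⟨?_, hsum, ?_⟩
  · rw [hterm]
    exact (latticeEquiv S hS).summable_iff.2 hsum
  · rw [smearedWigner, smearedWigner, hterm]
    exact (latticeEquiv S hS).tsum_eq _

end Smeared

/-! ### Cost-aware reasoning about programs -/

/-- The program `P`, run in the state `σ`, ends in a state with property `Q` at cost at most `c`. -/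
def Ends (P : Prog) (σ : State) (c : ℕ) (Q : State → Prop) : Prop :=
  Q (P.exec σ).1 ∧ (P.exec σ).2 ≤ c

theorem Ends.mono {P : Prog} {σ : State} {c c' : ℕ} {Q Q' : State → Prop} (h : Ends P σ c Q)
    (hc : c ≤ c') (hQ : ∀ τ, Q τ → Q' τ) : Ends P σ c' Q' :=
  ⟨hQ _ h.1, h.2.trans hc⟩

theorem Ends.mono_cost {P : Prog} {σ : State} {c c' : ℕ} {Q : State → Prop} (h : Ends P σ c Q)
    (hc : c ≤ c') : Ends P σ c' Q :=
  h.mono hc fun _ => id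

theorem Ends.seq {P P' : Prog} {σ : State} {c c' : ℕ} {Q R : State → Prop} (h : Ends P σ c R)
    (h' : ∀ τ, R τ → Ends P' τ c' Q) : Ends (.seq P P') σ (c + c') Q :=
  ⟨(h' _ h.1).1, Nat.add_le_add h.2 (h' _ h.1).2⟩

/-- `I k` is the invariant after k rounds. A round costs at most c plus the length M of the counter,
and entering the loop costs M once more. -/
theorem Ends.loop {P : Prog} {σ : State} {r N c M : ℕ} (I : ℕ → State → Prop)
    (hr : σ.reg r = N) (hM : bits (σ.reg r) ≤ M) (h0 : I 0 σ)
    (hstep : ∀ k < N, ∀ τ, I k τ → Ends P τ c (I (k + 1))) :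
    Ends (.loop r P) σ ((N + 1) * (c + M)) (I N) := by
  have key : ∀ k ≤ N, ∀ f : State × ℕ → State × ℕ,
      f = (fun τ : State × ℕ => ((P.exec τ.1).1, τ.2 + (P.exec τ.1).2 + bits (σ.reg r))) →
      I k (f^[k] (σ, bits (σ.reg r))).1 ∧
        (f^[k] (σ, bits (σ.reg r))).2 ≤ k * (c + M) + M := by
    intro k hk f hf
    induction k with
    | zero => exact ⟨h0, by simpa using hM⟩
    | succ k ih =>
      obtain ⟨h1, h2⟩ := ih (by omega)
      obtain ⟨h3, h4⟩ := hstep k (by omega) _ h1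
      rw [Function.iterate_succ_apply']
      generalize f^[k] (σ, bits (σ.reg r)) = τ at *
      subst hf
      refine ⟨h3, ?_⟩
      simp only
      rw [add_mul, one_mul]
      omega
  have h := key N le_rfl _ rfl
  have hN : (σ.reg r).toNat = N := by rw [hr, Int.toNat_natCast]
  refine ⟨?_, ?_⟩
  · rw [Prog.exec, hN]
    exact h.1
  · rw [Prog.exec, hN]
    refine h.2.trans ?_
    rw [add_mul, one_mul]
    omega

theorem State.reg_setReg (σ : State) (r r' : ℕ) (z : ℤ) :
    (σ.setReg r z).reg r' = if r' = r then z else σ.reg r' := by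
  simp [State.setReg, Function.update_apply]

theorem State.arr_setReg (σ : State) (r : ℕ) (z : ℤ) : (σ.setReg r z).arr = σ.arr := rfl

theorem State.reg_setArr (σ : State) (k i : ℕ) (z : ℤ) : (σ.setArr k i z).reg = σ.reg := rfl

theorem State.arr_setArr (σ : State) (k i k' : ℕ) (z : ℤ) :
    (σ.setArr k i z).arr k' =
      if k' = k then Function.update (σ.arr k) i z else σ.arr k' := by
  simp [State.setArr, Function.update_apply]

/-! ### Rules for single instructions, each at the uniform price M * M -/

section Instructions

variable {M : ℕ} {σ : State} {P : Prog} {c : ℕ} {Q : State → Prop}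

theorem two_mul_le_mul_self (hM : 2 ≤ M) : M + M ≤ M * M := by nlinarith

/-- The rest `P` of the program is part of the rule, so straight-line code is treated by chaining
such rules. -/
theorem Ends.const {r : ℕ} (z : ℤ) (hz : bits z ≤ M) (h : Ends P (σ.setReg r z) c Q) :
    Ends (.seq (.const r z) P) σ (M * M + c) Q :=
  Ends.seq (R := fun τ => τ = σ.setReg r z) ⟨rfl, hz.trans (Nat.le_mul_self M)⟩
    fun _ hτ => hτ ▸ h

theorem Ends.add_last (hM : 2 ≤ M) {r s t : ℕ} (x y : ℤ) (hx : σ.reg s = x) (hy : σ.reg t = y)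
    (hbx : bits x ≤ M) (hby : bits y ≤ M) (h : Q (σ.setReg r (x + y))) :
    Ends (.add r s t) σ (M * M) Q :=
  ⟨by rw [Prog.exec, hx, hy]; exact h,
    by rw [Prog.exec, hx, hy]; exact (Nat.add_le_add hbx hby).trans (two_mul_le_mul_self hM)⟩

theorem Ends.add (hM : 2 ≤ M) {r s t : ℕ} (x y : ℤ) (hx : σ.reg s = x) (hy : σ.reg t = y)
    (hbx : bits x ≤ M) (hby : bits y ≤ M) (h : Ends P (σ.setReg r (x + y)) c Q) :
    Ends (.seq (.add r s t) P) σ (M * M + c) Q :=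
  (Ends.add_last hM (Q := fun τ => τ = σ.setReg r (x + y)) x y hx hy hbx hby rfl).seq
    fun _ hτ => hτ ▸ h

theorem Ends.sub (hM : 2 ≤ M) {r s t : ℕ} (x y : ℤ) (hx : σ.reg s = x) (hy : σ.reg t = y)
    (hbx : bits x ≤ M) (hby : bits y ≤ M) (h : Ends P (σ.setReg r (x - y)) c Q) :
    Ends (.seq (.sub r s t) P) σ (M * M + c) Q :=
  Ends.seq (R := fun τ => τ = σ.setReg r (x - y))
    ⟨by rw [Prog.exec, hx, hy],
      by rw [Prog.exec, hx, hy]; exact (Nat.add_le_add hbx hby).trans (two_mul_le_mul_self hM)⟩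
    fun _ hτ => hτ ▸ h

theorem Ends.mul {r s t : ℕ} (x y : ℤ) (hx : σ.reg s = x) (hy : σ.reg t = y)
    (hbx : bits x ≤ M) (hby : bits y ≤ M) (h : Ends P (σ.setReg r (x * y)) c Q) :
    Ends (.seq (.mul r s t) P) σ (M * M + c) Q :=
  Ends.seq (R := fun τ => τ = σ.setReg r (x * y))
    ⟨by rw [Prog.exec, hx, hy], by rw [Prog.exec, hx, hy]; exact Nat.mul_le_mul hbx hby⟩
    fun _ hτ => hτ ▸ h

theorem Ends.load (hM : 2 ≤ M) {r k s : ℕ} (i : ℕ) (x : ℤ) (hi : σ.reg s = i) (hx : σ.arr k i = x)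
    (hbi : bits (i : ℤ) ≤ M) (hbx : bits x ≤ M) (h : Ends P (σ.setReg r x) c Q) :
    Ends (.seq (.load r k s) P) σ (M * M + c) Q :=
  Ends.seq (R := fun τ => τ = σ.setReg r x)
    ⟨by rw [Prog.exec, hi, Int.toNat_natCast, hx],
      by
        rw [Prog.exec, hi, Int.toNat_natCast, hx]
        exact (Nat.add_le_add hbi hbx).trans (two_mul_le_mul_self hM)⟩
    fun _ hτ => hτ ▸ h

theorem Ends.store (hM : 2 ≤ M) {r k s : ℕ} (i : ℕ) (x : ℤ) (hi : σ.reg s = i) (hx : σ.reg r = x)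
    (hbi : bits (i : ℤ) ≤ M) (hbx : bits x ≤ M) (h : Ends P (σ.setArr k i x) c Q) :
    Ends (.seq (.store k s r) P) σ (M * M + c) Q :=
  Ends.seq (R := fun τ => τ = σ.setArr k i x)
    ⟨by rw [Prog.exec, hi, Int.toNat_natCast, hx],
      by
        rw [Prog.exec, hi, Int.toNat_natCast, hx]
        exact (Nat.add_le_add hbi hbx).trans (two_mul_le_mul_self hM)⟩
    fun _ hτ => hτ ▸ h

end Instructions

/-! ### The program for the shift -/

/-- One step of the computation of `t̄ⱼ = ∑ₖ S k j * S (n + k) j`. -/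
def tbarStep : Prog :=
  -- Register 6 is the row-major address k·2n + j, register 3 the offset n·2n to the lower half,
  -- register 2 the row length, and register 5 the accumulator.
  .seq (.load 7 0 6) <| .seq (.add 8 6 3) <| .seq (.load 8 0 8) <| .seq (.mul 7 7 8) <|
    .seq (.add 5 5 7) <| .add 6 6 2

/-- The computation of `t̄ⱼ`, which is stored in array `2`. -/
def tbarEntry : Prog :=
  -- There is no copy instruction; j is copied from register 4 by adding it to zero.
  .seq (.const 5 0) <| .seq (.const 6 0) <| .seq (.add 6 6 4) <| .seq (.loop 0 tbarStep) <|
    .seq (.store 2 4 5) <| .add 4 4 1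

/-- One step of the computation of `∑ⱼ (S i (n + j) * t̄ⱼ - S i j * t̄₍ₙ₊ⱼ₎)`. -/
def shiftStep : Prog :=
  -- Register 4 is j and register 6 the address i·2n + j; adding n from register 0 moves to the `Z`
  -- columns or to the `Z` half of t̄.
  .seq (.add 7 6 0) <| .seq (.load 7 0 7) <| .seq (.load 8 2 4) <| .seq (.mul 7 7 8) <|
    .seq (.add 5 5 7) <| .seq (.load 7 0 6) <| .seq (.add 8 4 0) <| .seq (.load 8 2 8) <|
    .seq (.mul 7 7 8) <| .seq (.sub 5 5 7) <| .seq (.add 6 6 1) <| .add 4 4 1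

/-- The computation of an entry of the shift, which is stored in array `1`. -/
def shiftEntry : Prog :=
  -- Register 9 is the row i and register 11 its address i·2n.
  .seq (.const 5 0) <| .seq (.const 6 0) <| .seq (.add 6 6 11) <| .seq (.const 4 0) <|
    .seq (.loop 0 shiftStep) <| .seq (.store 1 9 5) <| .seq (.add 9 9 1) <| .add 11 11 2

/-- The computation of the shift. -/
def shiftProg : Prog :=
  -- Register 4, the index of the first loop, is not set because the input state has it zero.
  .seq (.const 1 1) <| .seq (.add 2 0 0) <| .seq (.mul 3 0 2) <| .seq (.loop 2 tbarEntry) <|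
    .seq (.const 9 0) <| .seq (.const 11 0) <| .loop 2 shiftEntry

/-! ### Loop invariants and costs of the program -/

section Correctness

variable (A : ℕ → ℤ) (n : ℕ)

/-- The sum of the first `m` terms of `t̄ⱼ` for the matrix that is stored in `A`. -/
def tbarSum (j m : ℕ) : ℤ :=
  ∑ k ∈ Finset.range m, A (k * (2 * n) + j) * A (k * (2 * n) + j + n * (2 * n))

/-- The sum of the first `m` terms of the entry `i` of the shift. -/
def shiftSum (i m : ℕ) : ℤ :=
  ∑ j ∈ Finset.range m, (A (i * (2 * n) + j + n) * tbarSum A n j n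
    - A (i * (2 * n) + j) * tbarSum A n (j + n) n)

/-- The registers and the array that are constant after the initialization. -/
structure IsInitialized (τ : State) : Prop where
  reg_zero : τ.reg 0 = n
  reg_one : τ.reg 1 = 1
  reg_two : τ.reg 2 = (2 * n : ℕ)
  reg_three : τ.reg 3 = (n * (2 * n) : ℕ)
  arr_zero : τ.arr 0 = A

/-- All numbers that occur in the computation have at most `M` bits. -/
structure FitsIn (M : ℕ) : Prop where
  two_le : 2 ≤ M
  index : ∀ p : ℕ, p ≤ 2 * n * (2 * n) → bits p ≤ M
  one : bits 1 ≤ M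
  entry : ∀ p, bits (A p) ≤ M
  entry_mul : ∀ p q, bits (A p * A q) ≤ M
  tbarSum : ∀ j, ∀ m ≤ n, bits (tbarSum A n j m) ≤ M
  entry_mul_tbarSum : ∀ p j, bits (A p * ZakGross.tbarSum A n j n) ≤ M
  shiftSum : ∀ i, ∀ m ≤ n, bits (shiftSum A n i m) ≤ M
  -- The accumulator between the addition and the subtraction of one step.
  shiftSum_add : ∀ i, ∀ m < n, ∀ p j,
    bits (ZakGross.shiftSum A n i m + A p * ZakGross.tbarSum A n j n) ≤ M

variable {A n} {M : ℕ}

theorem bits_zero_le (h : FitsIn A n M) : bits 0 ≤ M := h.index 0 (Nat.zero_le _)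

theorem IsInitialized.setReg {τ : State} (hτ : IsInitialized A n τ) {r : ℕ} (hr : 4 ≤ r) (z : ℤ) :
    IsInitialized A n (τ.setReg r z) where
  reg_zero := by rw [State.reg_setReg, if_neg (by omega), hτ.reg_zero]
  reg_one := by rw [State.reg_setReg, if_neg (by omega), hτ.reg_one]
  reg_two := by rw [State.reg_setReg, if_neg (by omega), hτ.reg_two]
  reg_three := by rw [State.reg_setReg, if_neg (by omega), hτ.reg_three]
  arr_zero := hτ.arr_zero

theorem IsInitialized.setArr {τ : State} (hτ : IsInitialized A n τ) {k : ℕ} (hk : k ≠ 0) (i : ℕ)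
    (z : ℤ) : IsInitialized A n (τ.setArr k i z) where
  reg_zero := hτ.reg_zero
  reg_one := hτ.reg_one
  reg_two := hτ.reg_two
  reg_three := hτ.reg_three
  arr_zero := by rw [State.arr_setArr, if_neg hk.symm, hτ.arr_zero]

theorem ends_tbarStep (h : FitsIn A n M) {j k : ℕ} (hj : j < 2 * n) (hk : k < n) {τ : State}
    (hτ : IsInitialized A n τ) (h4 : τ.reg 4 = j) (h5 : τ.reg 5 = tbarSum A n j k)
    (h6 : τ.reg 6 = (k * (2 * n) + j : ℕ)) (h2 : ∀ i < j, τ.arr 2 i = tbarSum A n i n) :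
    Ends tbarStep τ (6 * (M * M)) fun τ => IsInitialized A n τ ∧ τ.reg 4 = j ∧
      τ.reg 5 = tbarSum A n j (k + 1) ∧ τ.reg 6 = ((k + 1) * (2 * n) + j : ℕ) ∧
      ∀ i < j, τ.arr 2 i = tbarSum A n i n := by
  have hM := h.two_le
  have hp : k * (2 * n) + j + n * (2 * n) ≤ 2 * n * (2 * n) := by nlinarith
  have hp1 : k * (2 * n) + j ≤ 2 * n * (2 * n) := by omega
  have hp2 : n * (2 * n) ≤ 2 * n * (2 * n) := by omega
  have hp3 : 2 * n ≤ 2 * n * (2 * n) := by nlinarith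
  refine Ends.mono_cost (c := M * M + (M * M + (M * M + (M * M + (M * M + M * M))))) ?_ (by omega)
  refine Ends.load hM (k * (2 * n) + j) (A (k * (2 * n) + j)) h6 (by rw [hτ.arr_zero])
    (h.index _ hp1) (h.entry _) ?_
  refine Ends.add hM ((k * (2 * n) + j : ℕ) : ℤ) ((n * (2 * n) : ℕ) : ℤ)
    (by simp [State.reg_setReg, h6]) (by simp [State.reg_setReg, hτ.reg_three])
    (h.index _ hp1) (h.index _ hp2) ?_
  refine Ends.load hM (k * (2 * n) + j + n * (2 * n)) (A (k * (2 * n) + j + n * (2 * n)))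
    (by simp [State.reg_setReg]) (by simp [State.arr_setReg, hτ.arr_zero])
    (h.index _ hp) (h.entry _) ?_
  refine Ends.mul (A (k * (2 * n) + j)) (A (k * (2 * n) + j + n * (2 * n)))
    (by simp [State.reg_setReg]) (by simp [State.reg_setReg]) (h.entry _) (h.entry _) ?_
  refine Ends.add hM (tbarSum A n j k) (A (k * (2 * n) + j) * A (k * (2 * n) + j + n * (2 * n)))
    (by simp [State.reg_setReg, h5]) (by simp [State.reg_setReg])
    (h.tbarSum _ _ hk.le) (h.entry_mul _ _) ?_
  refine Ends.add_last hM ((k * (2 * n) + j : ℕ) : ℤ) ((2 * n : ℕ) : ℤ)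
    (by simp [State.reg_setReg, h6]) (by simp [State.reg_setReg, hτ.reg_two])
    (h.index _ hp1) (h.index _ hp3) ⟨?_, ?_, ?_, ?_, ?_⟩
  · iterate 6 refine IsInitialized.setReg ?_ (by norm_num) _
    exact hτ
  · simp [State.reg_setReg, h4]
  · simp [State.reg_setReg, tbarSum, Finset.sum_range_succ]
  · simp [State.reg_setReg]
    ring
  · simpa [State.arr_setReg] using h2

theorem ends_tbarEntry (h : FitsIn A n M) {j : ℕ} (hj : j < 2 * n) {τ : State}
    (hτ : IsInitialized A n τ) (h4 : τ.reg 4 = j) (h2 : ∀ i < j, τ.arr 2 i = tbarSum A n i n) :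
    Ends tbarEntry τ ((n + 6) * (7 * (M * M))) fun τ => IsInitialized A n τ ∧
      τ.reg 4 = (j + 1 : ℕ) ∧ ∀ i < j + 1, τ.arr 2 i = tbarSum A n i n := by
  have hM := h.two_le
  have hMM : M ≤ M * M := Nat.le_mul_self M
  have hj' : j ≤ 2 * n * (2 * n) := by nlinarith
  -- Five instructions and a loop of n rounds with six instructions each; M ≤ M² absorbs the loop
  -- counter into the 7.
  refine Ends.mono_cost (c := M * M + (M * M + (M * M + ((n + 1) * (6 * (M * M) + M) +
    (M * M + M * M))))) ?_ (by nlinarith)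
  refine Ends.const 0 (bits_zero_le h) (Ends.const 0 (bits_zero_le h) ?_)
  refine Ends.add hM 0 (j : ℤ) (by simp [State.reg_setReg]) (by simp [State.reg_setReg, h4])
    (bits_zero_le h) (h.index _ hj') ?_
  refine Ends.seq (Ends.loop (fun k τ => IsInitialized A n τ ∧ τ.reg 4 = j ∧
      τ.reg 5 = tbarSum A n j k ∧ τ.reg 6 = (k * (2 * n) + j : ℕ) ∧
      ∀ i < j, τ.arr 2 i = tbarSum A n i n) (N := n) ?_ ?_ ⟨?_, ?_, ?_, ?_, ?_⟩
      fun k hk υ hυ => ends_tbarStep h hj hk hυ.1 hυ.2.1 hυ.2.2.1 hυ.2.2.2.1 hυ.2.2.2.2) ?_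
  · simp [State.reg_setReg, hτ.reg_zero]
  · simp only [State.reg_setReg, hτ.reg_zero]
    exact h.index n (by nlinarith)
  · iterate 3 refine IsInitialized.setReg ?_ (by norm_num) _
    exact hτ
  · simp [State.reg_setReg, h4]
  · simp [State.reg_setReg, tbarSum]
  · simp [State.reg_setReg]
  · simpa [State.arr_setReg] using h2
  · rintro υ ⟨hυ, u4, u5, -, u2⟩
    refine Ends.store hM j (tbarSum A n j n) u4 u5 (h.index _ hj') (h.tbarSum _ _ le_rfl) ?_
    refine Ends.add_last hM (j : ℤ) 1 (by simp [State.reg_setArr, u4])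
      (by simp [State.reg_setArr, hυ.reg_one]) (h.index _ hj') h.one
      ⟨(hυ.setArr (by norm_num) _ _).setReg le_rfl _, by simp [State.reg_setReg], fun i hi => ?_⟩
    rw [State.arr_setReg, State.arr_setArr, if_pos rfl, Function.update_apply]
    split_ifs with hij
    · rw [hij]
    · exact u2 i (by omega)

theorem ends_shiftStep (h : FitsIn A n M) {i j : ℕ} (hi : i < 2 * n) (hj : j < n) {τ : State}
    (hτ : IsInitialized A n τ) (h2 : ∀ j < 2 * n, τ.arr 2 j = tbarSum A n j n)
    (h4 : τ.reg 4 = j) (h5 : τ.reg 5 = shiftSum A n i j)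
    (h6 : τ.reg 6 = (i * (2 * n) + j : ℕ)) (h9 : τ.reg 9 = i)
    (h11 : τ.reg 11 = (i * (2 * n) : ℕ)) (h1 : ∀ k < i, τ.arr 1 k = shiftSum A n k n) :
    Ends shiftStep τ (12 * (M * M)) fun τ => IsInitialized A n τ ∧
      (∀ j < 2 * n, τ.arr 2 j = tbarSum A n j n) ∧ τ.reg 4 = (j + 1 : ℕ) ∧
      τ.reg 5 = shiftSum A n i (j + 1) ∧ τ.reg 6 = (i * (2 * n) + (j + 1) : ℕ) ∧ τ.reg 9 = i ∧
      τ.reg 11 = (i * (2 * n) : ℕ) ∧ ∀ k < i, τ.arr 1 k = shiftSum A n k n := by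
  have hM := h.two_le
  have hp : i * (2 * n) + j + n ≤ 2 * n * (2 * n) := by nlinarith
  have hp1 : i * (2 * n) + j ≤ 2 * n * (2 * n) := by omega
  have hp2 : n ≤ 2 * n * (2 * n) := by omega
  have hp3 : j ≤ 2 * n * (2 * n) := by omega
  have hp4 : j + n ≤ 2 * n * (2 * n) := by omega
  refine Ends.mono_cost (c := M * M + (M * M + (M * M + (M * M + (M * M + (M * M + (M * M +
    (M * M + (M * M + (M * M + (M * M + M * M))))))))))) ?_ (by omega)
  refine Ends.add hM ((i * (2 * n) + j : ℕ) : ℤ) (n : ℤ) h6 hτ.reg_zero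
    (h.index _ hp1) (h.index _ hp2) ?_
  refine Ends.load hM (i * (2 * n) + j + n) (A (i * (2 * n) + j + n))
    (by simp [State.reg_setReg]) (by rw [State.arr_setReg, hτ.arr_zero])
    (h.index _ hp) (h.entry _) ?_
  refine Ends.load hM j (tbarSum A n j n) (by simp [State.reg_setReg, h4])
    (by simp only [State.arr_setReg, h2 j (by omega)]) (h.index _ hp3) (h.tbarSum _ _ le_rfl) ?_
  refine Ends.mul (A (i * (2 * n) + j + n)) (tbarSum A n j n) (by simp [State.reg_setReg])
    (by simp [State.reg_setReg]) (h.entry _) (h.tbarSum _ _ le_rfl) ?_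
  refine Ends.add hM (shiftSum A n i j) (A (i * (2 * n) + j + n) * tbarSum A n j n)
    (by simp [State.reg_setReg, h5]) (by simp [State.reg_setReg])
    (h.shiftSum _ _ hj.le) (h.entry_mul_tbarSum _ _) ?_
  refine Ends.load hM (i * (2 * n) + j) (A (i * (2 * n) + j))
    (by simp [State.reg_setReg, h6]) (by simp only [State.arr_setReg, hτ.arr_zero])
    (h.index _ hp1) (h.entry _) ?_
  refine Ends.add hM (j : ℤ) (n : ℤ) (by simp [State.reg_setReg, h4])
    (by simp [State.reg_setReg, hτ.reg_zero]) (h.index _ hp3) (h.index _ hp2) ?_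
  refine Ends.load hM (j + n) (tbarSum A n (j + n) n) (by simp [State.reg_setReg])
    (by simp only [State.arr_setReg, h2 (j + n) (by omega)]) (h.index _ hp4)
    (h.tbarSum _ _ le_rfl) ?_
  refine Ends.mul (A (i * (2 * n) + j)) (tbarSum A n (j + n) n) (by simp [State.reg_setReg])
    (by simp [State.reg_setReg]) (h.entry _) (h.tbarSum _ _ le_rfl) ?_
  refine Ends.sub hM (shiftSum A n i j + A (i * (2 * n) + j + n) * tbarSum A n j n)
    (A (i * (2 * n) + j) * tbarSum A n (j + n) n)
    (by simp [State.reg_setReg]) (by simp [State.reg_setReg])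
    (h.shiftSum_add _ _ hj _ _) (h.entry_mul_tbarSum _ _) ?_
  refine Ends.add hM ((i * (2 * n) + j : ℕ) : ℤ) 1 (by simp [State.reg_setReg, h6])
    (by simp [State.reg_setReg, hτ.reg_one]) (h.index _ hp1) h.one ?_
  refine Ends.add_last hM (j : ℤ) 1 (by simp [State.reg_setReg, h4])
    (by simp [State.reg_setReg, hτ.reg_one]) (h.index _ hp3) h.one
    ⟨?_, ?_, ?_, ?_, ?_, ?_, ?_, ?_⟩
  · iterate 12 refine IsInitialized.setReg ?_ (by norm_num) _
    exact hτ
  · simpa only [State.arr_setReg] using h2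
  · simp [State.reg_setReg]
  · simp [State.reg_setReg, shiftSum, Finset.sum_range_succ]
    ring
  · simp [State.reg_setReg]
    ring
  · simp [State.reg_setReg, h9]
  · simp [State.reg_setReg, h11]
  · simpa only [State.arr_setReg] using h1

theorem ends_shiftEntry (h : FitsIn A n M) {i : ℕ} (hi : i < 2 * n) {τ : State}
    (hτ : IsInitialized A n τ) (h2 : ∀ j < 2 * n, τ.arr 2 j = tbarSum A n j n)
    (h9 : τ.reg 9 = i) (h11 : τ.reg 11 = (i * (2 * n) : ℕ))
    (h1 : ∀ k < i, τ.arr 1 k = shiftSum A n k n) :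
    Ends shiftEntry τ ((n + 8) * (13 * (M * M))) fun τ => IsInitialized A n τ ∧
      (∀ j < 2 * n, τ.arr 2 j = tbarSum A n j n) ∧ τ.reg 9 = (i + 1 : ℕ) ∧
      τ.reg 11 = ((i + 1) * (2 * n) : ℕ) ∧ ∀ k < i + 1, τ.arr 1 k = shiftSum A n k n := by
  have hM := h.two_le
  have hMM : M ≤ M * M := Nat.le_mul_self M
  have hi' : i ≤ 2 * n * (2 * n) := by nlinarith
  have hp : i * (2 * n) ≤ 2 * n * (2 * n) := by nlinarith
  have hp2 : 2 * n ≤ 2 * n * (2 * n) := by nlinarith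
  refine Ends.mono_cost (c := M * M + (M * M + (M * M + (M * M + ((n + 1) * (12 * (M * M) + M) +
    (M * M + (M * M + M * M))))))) ?_ (by nlinarith)
  refine Ends.const 0 (bits_zero_le h) (Ends.const 0 (bits_zero_le h) ?_)
  refine Ends.add hM 0 ((i * (2 * n) : ℕ) : ℤ) (by simp [State.reg_setReg])
    (by simp [State.reg_setReg, h11]) (bits_zero_le h) (h.index _ hp) ?_
  refine Ends.const 0 (bits_zero_le h) ?_
  refine Ends.seq (Ends.loop (fun j τ => IsInitialized A n τ ∧
      (∀ j < 2 * n, τ.arr 2 j = tbarSum A n j n) ∧ τ.reg 4 = j ∧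
      τ.reg 5 = shiftSum A n i j ∧ τ.reg 6 = (i * (2 * n) + j : ℕ) ∧ τ.reg 9 = i ∧
      τ.reg 11 = (i * (2 * n) : ℕ) ∧ ∀ k < i, τ.arr 1 k = shiftSum A n k n) (N := n) ?_ ?_
      ⟨?_, ?_, ?_, ?_, ?_, ?_, ?_, ?_⟩
      fun j hj υ ⟨u0, u2, u4, u5, u6, u9, u11, u1⟩ =>
        ends_shiftStep h hi hj u0 u2 u4 u5 u6 u9 u11 u1) ?_
  · simp [State.reg_setReg, hτ.reg_zero]
  · simp only [State.reg_setReg, hτ.reg_zero]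
    exact h.index n (by omega)
  · iterate 4 refine IsInitialized.setReg ?_ (by norm_num) _
    exact hτ
  · simpa only [State.arr_setReg] using h2
  · simp [State.reg_setReg]
  · simp [State.reg_setReg, shiftSum]
  · simp [State.reg_setReg]
  · simp [State.reg_setReg, h9]
  · simp [State.reg_setReg, h11]
  · simpa only [State.arr_setReg] using h1
  · rintro υ ⟨hυ, u2, -, u5, -, u9, u11, u1⟩
    refine Ends.store hM i (shiftSum A n i n) u9 u5 (h.index _ hi') (h.shiftSum _ _ le_rfl) ?_
    refine Ends.add hM (i : ℤ) 1 (by simp [State.reg_setArr, u9])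
      (by simp [State.reg_setArr, hυ.reg_one]) (h.index _ hi') h.one ?_
    refine Ends.add_last hM ((i * (2 * n) : ℕ) : ℤ) ((2 * n : ℕ) : ℤ)
      (by simp [State.reg_setReg, State.reg_setArr, u11])
      (by simp [State.reg_setReg, State.reg_setArr, hυ.reg_two]) (h.index _ hp) (h.index _ hp2)
      ⟨((hυ.setArr (by norm_num) _ _).setReg (by norm_num) _).setReg (by norm_num) _,
        ?_, ?_, ?_, fun k hk => ?_⟩
    · simpa [State.arr_setReg, State.arr_setArr] using u2
    · simp [State.reg_setReg]
    · simp [State.reg_setReg]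
      ring
    · rw [State.arr_setReg, State.arr_setReg, State.arr_setArr, if_pos rfl, Function.update_apply]
      split_ifs with hik
      · rw [hik]
      · exact u1 k (by omega)

theorem ends_shiftProg (h : FitsIn A n M) {σ : State} (h0 : σ.reg 0 = n)
    (hreg : ∀ r ≠ 0, σ.reg r = 0) (hA : σ.arr 0 = A) :
    Ends shiftProg σ ((2 * n + 4) * ((n + 8) * (22 * (M * M)))) fun τ =>
      ∀ i < 2 * n, τ.arr 1 i = shiftSum A n i n := by
  have hM := h.two_le
  have hMM : M ≤ M * M := Nat.le_mul_self M
  have hn : n ≤ 2 * n * (2 * n) := by nlinarith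
  have hp : 2 * n ≤ 2 * n * (2 * n) := by nlinarith
  refine Ends.mono_cost (c := M * M + (M * M + (M * M +
    ((2 * n + 1) * ((n + 6) * (7 * (M * M)) + M) + (M * M + (M * M +
      (2 * n + 1) * ((n + 8) * (13 * (M * M)) + M))))))) ?_ ?_
  · refine Ends.const 1 h.one ?_
    refine Ends.add hM (n : ℤ) (n : ℤ) (by simp [State.reg_setReg, h0])
      (by simp [State.reg_setReg, h0]) (h.index _ hn) (h.index _ hn) ?_
    refine Ends.mul (n : ℤ) ((2 * n : ℕ) : ℤ) (by simp [State.reg_setReg, h0])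
      (by simp [State.reg_setReg]; ring) (h.index _ hn) (h.index _ hp) ?_
    refine Ends.seq (Ends.loop (fun j τ => IsInitialized A n τ ∧ τ.reg 4 = j ∧
        ∀ i < j, τ.arr 2 i = tbarSum A n i n) (N := 2 * n)
        ?_ ?_ ⟨⟨?_, ?_, ?_, ?_, ?_⟩, ?_, ?_⟩
        fun j hj υ ⟨u0, u4, u2⟩ => ends_tbarEntry h hj u0 u4 u2) ?_
    · simp [State.reg_setReg]
      ring
    · simp only [State.reg_setReg]
      norm_num
      rw [← two_mul]
      exact_mod_cast h.index _ hp
    · simp [State.reg_setReg, h0]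
    · simp [State.reg_setReg]
    · simp [State.reg_setReg]
      ring
    · simp [State.reg_setReg]
    · simpa only [State.arr_setReg] using hA
    · simp [State.reg_setReg, hreg]
    · simp
    · rintro υ ⟨hυ, -, u2⟩
      refine Ends.const 0 (bits_zero_le h) (Ends.const 0 (bits_zero_le h) ?_)
      refine Ends.mono (Ends.loop (fun i τ => IsInitialized A n τ ∧
        (∀ j < 2 * n, τ.arr 2 j = tbarSum A n j n) ∧ τ.reg 9 = i ∧
        τ.reg 11 = (i * (2 * n) : ℕ) ∧ ∀ k < i, τ.arr 1 k = shiftSum A n k n) (N := 2 * n)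
        ?_ ?_ ⟨?_, ?_, ?_, ?_, ?_⟩
        fun i hi υ ⟨u0, u2, u9, u11, u1⟩ => ends_shiftEntry h hi u0 u2 u9 u11 u1) le_rfl
        fun τ hτ => hτ.2.2.2.2
      · simp [State.reg_setReg, hυ.reg_two]
      · simp only [State.reg_setReg, hυ.reg_two]
        exact h.index _ hp
      · exact (hυ.setReg (by norm_num) _).setReg (by norm_num) _
      · simpa only [State.arr_setReg] using u2
      · simp [State.reg_setReg]
      · simp [State.reg_setReg]
      · simp
  -- The loop counters raise 7 and 13 to 8 and 14, whose sum is 22; the five instructions outside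
  -- the loops are absorbed by 2n + 4.
  · generalize M * M = K at *
    have h1 : (n + 6) * (7 * K) + M ≤ (n + 8) * (8 * K) := by nlinarith
    have h2 : (n + 8) * (13 * K) + M ≤ (n + 8) * (14 * K) := by nlinarith
    have h3 : 5 * K ≤ (n + 8) * (22 * K) := by nlinarith
    calc _ ≤ K + (K + (K + ((2 * n + 1) * ((n + 8) * (8 * K)) + (K + (K +
          (2 * n + 1) * ((n + 8) * (14 * K))))))) := by gcongr
      _ = (2 * n + 1) * ((n + 8) * (22 * K)) + 5 * K := by ring
      _ ≤ (2 * n + 4) * ((n + 8) * (22 * K)) := by nlinarith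

/-- The bound for the number of bits of a number of bounded absolute value. -/
theorem bits_le_of_abs_le {z : ℤ} {m : ℕ} (h : |z| < 2 ^ m) : bits z ≤ m + 1 := by
  refine Nat.succ_le_succ (Nat.size_le.2 ?_)
  zify
  exact h

theorem abs_lt_two_pow_bits (z : ℤ) : |z| < 2 ^ bits z := by
  have h : z.natAbs < 2 ^ bits z := Nat.size_le.1 (Nat.le_succ _)
  zify at h
  exact h

/-! ### Sizes of the intermediate integers -/

theorem abs_tbarSum_le {X : ℤ} (hA : ∀ p, |A p| ≤ X) (j m : ℕ) :
    |tbarSum A n j m| ≤ m * (X * X) := by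
  refine (Finset.abs_sum_le_sum_abs _ _).trans ?_
  refine (Finset.sum_le_card_nsmul _ _ (X * X) fun k _ => ?_).trans (by simp)
  rw [abs_mul]
  exact mul_le_mul (hA _) (hA _) (abs_nonneg _) ((abs_nonneg _).trans (hA 0))

theorem abs_entry_mul_tbarSum_le {X : ℤ} (hA : ∀ p, |A p| ≤ X) (p j : ℕ) :
    |A p * tbarSum A n j n| ≤ X * (n * (X * X)) := by
  rw [abs_mul]
  exact mul_le_mul (hA _) (abs_tbarSum_le hA _ _) (abs_nonneg _) ((abs_nonneg _).trans (hA 0))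

theorem abs_shiftSum_le {X : ℤ} (hA : ∀ p, |A p| ≤ X) (i m : ℕ) :
    |shiftSum A n i m| ≤ m * (2 * (X * (n * (X * X)))) := by
  refine (Finset.abs_sum_le_sum_abs _ _).trans ?_
  refine (Finset.sum_le_card_nsmul _ _ (2 * (X * (n * (X * X)))) fun j _ => ?_).trans (by simp)
  refine (abs_sub _ _).trans ?_
  have h1 := abs_entry_mul_tbarSum_le hA (n := n) (i * (2 * n) + j + n) j
  have h2 := abs_entry_mul_tbarSum_le hA (n := n) (i * (2 * n) + j) (j + n)
  linarith

/-- With X = 2^L, all values are at most cubic in X times a factor of at most 2n², and 4n² ≤ L ≤ X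
bounds everything by X⁴. -/
theorem fitsIn_of_abs_le {L : ℕ} (hL : 1 ≤ L) (hnL : 2 * n * (2 * n) ≤ L)
    (hA : ∀ p, |A p| ≤ 2 ^ L) : FitsIn A n (4 * L + 4) := by
  have hnL' : n * n * 4 ≤ L := by linarith
  have hX : (L : ℤ) ≤ 2 ^ L := by exact_mod_cast Nat.lt_two_pow_self.le
  have hX1 : (1 : ℤ) ≤ 2 ^ L := one_le_pow₀ (by norm_num)
  -- The factor 8 is slack that makes the bound by X⁴ strict.
  have hpow : (2 : ℤ) ^ (4 * L + 3) = 8 * ((2 ^ L) * (2 ^ L) * (2 ^ L) * (2 ^ L)) := by ring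
  have key : ∀ z : ℤ, |z| ≤ 2 ^ L * (2 ^ L * 2 ^ L * 2 ^ L) → bits z ≤ 4 * L + 4 := by
    intro z hz
    refine bits_le_of_abs_le (m := 4 * L + 3) ?_
    rw [hpow]
    have : (0 : ℤ) < 2 ^ L * (2 ^ L * 2 ^ L * 2 ^ L) := by positivity
    linarith
  have hn : (n : ℤ) * n * 4 ≤ L := by exact_mod_cast hnL'
  have hn0 : (0 : ℤ) ≤ n := Int.natCast_nonneg n
  have hn1 : (n : ℤ) ≤ L := by nlinarith
  generalize (2 : ℤ) ^ L = X at *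
  have hX2 : X * 1 ≤ X * (X * X * X) := by
    gcongr
    nlinarith
  have hX3 : X * X * 1 ≤ X * X * (X * X) := by
    gcongr
    nlinarith
  have hT : ∀ m : ℕ, m ≤ n → (m : ℤ) * (X * X) ≤ X * (X * X) := fun m hm => by
    gcongr
    exact (Int.ofNat_le.2 hm).trans (hn1.trans hX)
  refine ⟨by omega, fun p hp => key _ ?_, key _ ?_, fun p => key _ ?_, fun p q => key _ ?_,
    fun j m hm => key _ ?_, fun p j => key _ ?_, fun i m hm => key _ ?_,
    fun i m hm p j => key _ ?_⟩
  · rw [abs_of_nonneg (Int.natCast_nonneg p)]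
    have : (p : ℤ) ≤ L := by exact_mod_cast hp.trans hnL
    linarith
  · rw [abs_one]
    linarith
  · linarith [hA p]
  · rw [abs_mul]
    have := mul_le_mul (hA p) (hA q) (abs_nonneg _) (by linarith)
    nlinarith
  · calc _ ≤ (m : ℤ) * (X * X) := abs_tbarSum_le hA _ _
      _ ≤ X * (X * X) := hT m hm
      _ = X * (X * X * 1) := by ring
      _ ≤ X * (X * X * X) := by gcongr
  · calc _ ≤ X * (n * (X * X)) := abs_entry_mul_tbarSum_le hA _ _
      _ ≤ X * (X * (X * X)) := by gcongr; linarith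
      _ = X * (X * X * X) := by ring
  · have hm' : (m : ℤ) ≤ n := by exact_mod_cast hm
    have hmn : (m : ℤ) * (2 * n) ≤ X := by nlinarith
    calc _ ≤ (m : ℤ) * (2 * (X * (n * (X * X)))) := abs_shiftSum_le hA _ _
      _ = m * (2 * n) * (X * X * X) := by ring
      _ ≤ X * (X * X * X) := by gcongr
  · have hm' : (m : ℤ) + 1 ≤ n := by exact_mod_cast hm
    have hmn : (m : ℤ) * (2 * n) + n ≤ X := by nlinarith
    calc _ ≤ (m : ℤ) * (2 * (X * (n * (X * X)))) + X * (n * (X * X)) :=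
          (abs_add_le _ _).trans
            (add_le_add (abs_shiftSum_le hA _ _) (abs_entry_mul_tbarSum_le hA _ _))
      _ = (m * (2 * n) + n) * (X * X * X) := by ring
      _ ≤ X * (X * X * X) := by gcongr

end Correctness

/-! ### From the stored array back to the matrix -/

section MatrixArray

variable {n : ℕ} (S : Matrix (Fin n ⊕ Fin n) (Fin n ⊕ Fin n) ℤ)

theorem position_inl (j : Fin n) : position (Sum.inl j : Fin n ⊕ Fin n) = j := by
  simp [position]

theorem position_inr (j : Fin n) : position (Sum.inr j : Fin n ⊕ Fin n) = j + n := by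
  simp [position, add_comm]

theorem position_lt (i : Fin n ⊕ Fin n) : position i < 2 * n :=
  (finSumFinEquiv i).isLt.trans_eq (two_mul n).symm

theorem matrixArray_position (i j : Fin n ⊕ Fin n) :
    matrixArray S (position i * (2 * n) + position j) = S i j := by
  have h : position i * (2 * n) + position j =
      (finProdFinEquiv (finSumFinEquiv i, finSumFinEquiv j) : Fin ((n + n) * (n + n))) := by
    simp only [finProdFinEquiv_apply_val, position]
    ring
  rw [h, matrixArray, dif_pos (Fin.isLt _), Fin.eta, Equiv.symm_apply_apply]
  simp

/-- For both kinds of index, t̄ⱼ is the product of the upper and lower halves of column j, so a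
single loop covers AᵀC and BᵀD. -/
theorem tbarSum_matrixArray (j : Fin n ⊕ Fin n) :
    tbarSum (matrixArray S) n (position j) n = tbar S j := by
  have h : ∀ k : Fin n, (k : ℕ) * (2 * n) + position j + n * (2 * n) =
      position (Sum.inr k : Fin n ⊕ Fin n) * (2 * n) + position j := fun k => by
    rw [position_inr]
    ring
  rw [tbarSum, Finset.sum_range]
  simp only [h]
  simp only [← position_inl, matrixArray_position]
  cases j <;> simp [tbar, Matrix.mul_apply, Matrix.toBlocks₁₁, Matrix.toBlocks₁₂,
    Matrix.toBlocks₂₁, Matrix.toBlocks₂₂]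

theorem shiftCoeff_apply (i : Fin n ⊕ Fin n) : shiftCoeff S i =
    ∑ j, (S i (Sum.inr j) * tbar S (Sum.inl j) - S i (Sum.inl j) * tbar S (Sum.inr j)) := by
  rw [shiftCoeff, Omega_inv, ← Matrix.mulVec_mulVec, Matrix.neg_mulVec, Matrix.mulVec_neg,
    Pi.neg_apply]
  change -((S i) ⬝ᵥ (Omega n ℤ *ᵥ tbar S)) = _
  rw [dotProduct_Omega_mulVec, ← Finset.sum_neg_distrib]
  exact Finset.sum_congr rfl fun j _ => by ring

theorem shiftSum_matrixArray (i : Fin n ⊕ Fin n) :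
    shiftSum (matrixArray S) n (position i) n = shiftCoeff S i := by
  rw [shiftCoeff_apply, shiftSum, Finset.sum_range]
  simp only [add_assoc, ← position_inr]
  simp only [← position_inl, matrixArray_position, tbarSum_matrixArray]

theorem bits_le_bitLength (i j : Fin n ⊕ Fin n) : bits (S i j) ≤ bitLength S :=
  (Finset.single_le_sum (f := fun j => bits (S i j)) (fun _ _ => Nat.zero_le _)
    (Finset.mem_univ j)).trans
    (Finset.single_le_sum (f := fun i => ∑ j, bits (S i j)) (fun _ _ => Nat.zero_le _)
      (Finset.mem_univ i))

/-- Even a zero entry has its sign bit; hence a cost polynomial in n is polynomial in the bit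
length. -/
theorem card_le_bitLength : 2 * n * (2 * n) ≤ bitLength S := by
  have h : ∑ _i : Fin n ⊕ Fin n, ∑ _j : Fin n ⊕ Fin n, 1 ≤ bitLength S :=
    Finset.sum_le_sum fun i _ => Finset.sum_le_sum fun j _ => Nat.succ_le_succ (Nat.zero_le _)
  simpa [← two_mul] using h

theorem abs_matrixArray_le (p : ℕ) : |matrixArray S p| ≤ 2 ^ (bitLength S + 1) := by
  rw [matrixArray]
  split_ifs
  · exact (abs_lt_two_pow_bits _).le.trans
      (pow_le_pow_right₀ (by norm_num) ((bits_le_bitLength S _ _).trans (Nat.le_succ _)))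
  · rw [abs_zero]
    positivity

end MatrixArray

theorem polyTimeOn_shiftCoeff
    (p : ∀ n : ℕ, Matrix (Fin n ⊕ Fin n) (Fin n ⊕ Fin n) ℤ → Prop) :
    PolyTimeOn p fun _ S => shiftCoeff S := by
  -- 76032 = 6·9·22·8², from 2n + 4 ≤ 6L, n + 8 ≤ 9L and 4L + 4 ≤ 8L with L the bit length plus one.
  refine ⟨shiftProg, 76032, 4, fun n S _ => ?_⟩
  have hcard := card_le_bitLength S
  have hfit := fitsIn_of_abs_le (A := matrixArray S) (n := n) (L := bitLength S + 1)
    (Nat.le_add_left 1 _) (hcard.trans (Nat.le_succ _)) (abs_matrixArray_le S)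
  obtain ⟨h1, h2⟩ := ends_shiftProg hfit (σ := inputState S) rfl
    (fun r hr => by simp [inputState, hr]) rfl
  refine ⟨fun i => ?_, h2.trans ?_⟩
  · rw [h1 _ (position_lt i), shiftSum_matrixArray]
  · have hn : n ≤ bitLength S + 1 := by nlinarith
    have hL : 1 ≤ bitLength S + 1 := Nat.le_add_left 1 _
    generalize bitLength S + 1 = L at hn hL ⊢
    calc (2 * n + 4) * ((n + 8) * (22 * ((4 * L + 4) * (4 * L + 4))))
        ≤ (6 * L) * ((9 * L) * (22 * ((8 * L) * (8 * L)))) := by gcongr <;> omega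
      _ = 76032 * L ^ 4 := by ring

end ZakGross

theorem theorem1 :
    (∀ (n d : ℕ), Odd d →
      ∀ S : Matrix (Fin n ⊕ Fin n) (Fin n ⊕ Fin n) ℤ, S ∈ Matrix.symplecticGroup (Fin n) ℤ →
      ∀ U : ZakGross.Modes n →L[ℂ] ZakGross.Modes n,
        ZakGross.IsGaussianUnitary (ZakGross.realMat S) U →
      ∀ ρ : ZakGross.Modes n →L[ℂ] ZakGross.Modes n, ZakGross.IsDensityOperator ρ →
        -- the identity at every point `η` (both series converge, or neither does)
        (∀ η : Fin n ⊕ Fin n → ℝ,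
          (Summable (ZakGross.wignerTerm d (U * ρ * star U) η) ↔
            Summable (ZakGross.wignerTerm d ρ (ZakGross.realMat S *ᵥ η - ZakGross.shift d S))) ∧
          ZakGross.zakGrossWigner d (U * ρ * star U) η =
            ZakGross.zakGrossWigner d ρ (ZakGross.realMat S *ᵥ η - ZakGross.shift d S)) ∧
        -- the identity of distributions (both series always converge)
        (∀ φ : 𝓢(Fin n ⊕ Fin n → ℝ, ℂ),
          Summable (ZakGross.smearedTerm d (U * ρ * star U) φ) ∧
          Summable (ZakGross.smearedTerm d ρ
            (fun ξ => φ ((ZakGross.realMat S)⁻¹ *ᵥ (ξ + ZakGross.shift d S)))) ∧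
          ZakGross.smearedWigner d (U * ρ * star U) φ =
            ZakGross.smearedWigner d ρ
              (fun ξ => φ ((ZakGross.realMat S)⁻¹ *ᵥ (ξ + ZakGross.shift d S))))) ∧
    -- the integer vector `S Ω⁻¹ t̄`, which gives the shift in units of `π/ℓ`, is computable in
    -- polynomial time from `S`
    ZakGross.PolyTimeOn (fun n S => S ∈ Matrix.symplecticGroup (Fin n) ℤ)
      (fun _ S => ZakGross.shiftCoeff S) :=
  ⟨fun _ _ hd _ hS _ hU _ hρ =>
    ⟨fun η => ZakGross.zakGrossWigner_conj hd.pos hS hU hρ η,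
      fun φ => ZakGross.smearedWigner_conj hd.pos hS hU hρ φ⟩,
    ZakGross.polyTimeOn_shiftCoeff _⟩
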